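/- Let $N\in\mathbb N$. For a choice of ground field ($\mathbb R$ or $\mathbb C$) and of one of five types (classical, half-classical, free, twisted half-classical, twisted), define unital $C^*$-algebras $C(S^{N-1}_\times)$ and $C(U_N^\times)$ by generators and relations, as universal $C^*$-algebras: - $C(S^{N-1}_\times)$ has generators $z_1,\dots,z_N$, with $\sum_iz_iz_i^*=\sum_iz_i^*z_i=1$, with $z_i=z_i^*$ for all $i$ in the real case, and with commutation relations of the given type. - $C(U_N^\times)$ has generators $u_{ij}$ ($1\le i,j\le N$), with $u=(u_{ij})$ satisfying $uu^*=u^*u=1$ and $u^t\bar u=\bar uu^t=1$, with $u_{ij}=u_{ij}^*$ for all $i,j$ in the real case, and with commutation relations of the given type. The commutation relations are the following, where $a,b,c$ are arbitrary generators and $\alpha\in\{a,a^*\}$, $\beta\in\{b,b^*\}$, $\gamma\in\{c,c^*\}$. Classical: $\alpha\beta=\beta\alpha$. Half-classical: $\alpha\beta\gamma=\gamma\beta\alpha$. Free: none. Twisted: $\alpha\beta=-\beta\alpha$ if $a\ne b$ (for the sphere), respectively if $a\neq b$ lie on the same row or column of $u$ (for the quantum group), and $\alpha\beta=\beta\alpha$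 otherwise. Twisted half-classical: $\alpha\beta\gamma=-\gamma\beta\alpha$ if $a,b,c$ are distinct (for the sphere), respectively if, with $r,s$ the numbers of rows and columns of $u$ met by $a,b,c$, one has $(r\le2,s=3)$ or $(r=3,s\le 2)$ (for the quantum group), and $\alpha\beta\gamma=\gamma\beta\alpha$ otherwise. Let $\otimes$ be the minimal tensor product of $C^*$-algebras. Then for each of these 10 choices there are unital $*$-homomorphisms $\Delta:C(U_N^\times)\to C(U_N^\times)\otimes C(U_N^\times)$ and $\varepsilon:C(U_N^\times)\to\mathbb C$ with $\Delta(u_{ij})=\sum_ku_{ik}\otimes u_{kj}$ and $\varepsilon(u_{ij})=\delta_{ij}$, and the quantum group $U_N^\times$ acts on $S^{N-1}_\times$ by $z_i\mapsto\sum_ju_{ij}\otimes z_j$. That is, there is a unital $*$-homomorphism $$\Phi:C(S^{N-1}_\times)\to C(U_N^\times)\otimes C(S^{N-1}_\times),\qquad \Phi(z_i)=\sum_ju_{ij}\otimes z_j,$$ such that: 1. $(id\otimes\Phi)\Phi=(\Delta\otimes id)\Phi$; 2. $(\varepsilon\otimes id)\Phi=id$; 3. the linear span of $\Phi(C(S^{N-1}_\times))\,(C(U_N^\times)\otimes1)$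 is dense in $C(U_N^\times)\otimes C(S^{N-1}_\times)$. -/

import Mathlib

open scoped TensorProduct

noncomputable section

/-! ## The free `*`-algebra -/

/-- The free complex unital `*`-algebra `ℂ⟨x, x^* : x ∈ X⟩`: noncommutative polynomials in the
letters `(x, false)`, standing for `x`, and `(x, true)`, standing for `x^*`. -/
def FreeStarAlgebra (X : Type) : Type := FreeAlgebra ℂ (X × Bool)

namespace FreeStarAlgebra

variable {X : Type}

instance : Ring (FreeStarAlgebra X) := inferInstanceAs (Ring (FreeAlgebra ℂ (X × Bool)))

instance : Algebra ℂ (FreeStarAlgebra X) :=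
  inferInstanceAs (Algebra ℂ (FreeAlgebra ℂ (X × Bool)))

/-- The letter `x` (for `s = false`) or `x^*` (for `s = true`). -/
def letter (x : X) (s : Bool) : FreeStarAlgebra X := FreeAlgebra.ι ℂ (x, s)

/-- The free generator attached to `x`. -/
def gen (x : X) : FreeStarAlgebra X := letter x false

theorem induction {motive : FreeStarAlgebra X → Prop}
    (scalar : ∀ r : ℂ, motive (algebraMap ℂ (FreeStarAlgebra X) r))
    (letter : ∀ x s, motive (letter x s))
    (mul : ∀ a b, motive a → motive b → motive (a * b))
    (add : ∀ a b, motive a → motive b → motive (a + b)) (a : FreeStarAlgebra X) : motive a :=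
  FreeAlgebra.induction ℂ (X × Bool) (motive := motive) scalar (fun x => letter x.1 x.2) mul add a

/-- The conjugate-linear antiautomorphism exchanging `x` and `x^*`, as a ring homomorphism into
the opposite ring. -/
def starHom : FreeStarAlgebra X →+* (FreeStarAlgebra X)ᵐᵒᵖ :=
  letI : Algebra ℂ (FreeStarAlgebra X)ᵐᵒᵖ :=
    RingHom.toAlgebra' ((algebraMap ℂ (FreeStarAlgebra X)ᵐᵒᵖ).comp (starRingEnd ℂ))
      fun c x => Algebra.commutes (starRingEnd ℂ c) x
  (FreeAlgebra.lift ℂ (A := (FreeStarAlgebra X)ᵐᵒᵖ)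
    fun x : X × Bool => MulOpposite.op (letter x.1 !x.2)).toRingHom

theorem starHom_letter (x : X) (s : Bool) :
    starHom (letter x s) = MulOpposite.op (letter x !s) := by
  let _ : Algebra ℂ (FreeStarAlgebra X)ᵐᵒᵖ :=
    RingHom.toAlgebra' ((algebraMap ℂ (FreeStarAlgebra X)ᵐᵒᵖ).comp (starRingEnd ℂ))
      fun c x => Algebra.commutes (starRingEnd ℂ c) x
  exact FreeAlgebra.lift_ι_apply (A := (FreeStarAlgebra X)ᵐᵒᵖ)
    (fun x : X × Bool => MulOpposite.op (letter x.1 !x.2)) (x, s)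

theorem starHom_algebraMap (r : ℂ) :
    starHom (algebraMap ℂ (FreeStarAlgebra X) r) =
      MulOpposite.op (algebraMap ℂ (FreeStarAlgebra X) (star r)) := by
  let _ : Algebra ℂ (FreeStarAlgebra X)ᵐᵒᵖ :=
    RingHom.toAlgebra' ((algebraMap ℂ (FreeStarAlgebra X)ᵐᵒᵖ).comp (starRingEnd ℂ))
      fun c x => Algebra.commutes (starRingEnd ℂ c) x
  exact (FreeAlgebra.lift ℂ (A := (FreeStarAlgebra X)ᵐᵒᵖ)
    fun x : X × Bool => MulOpposite.op (letter x.1 !x.2)).commutes r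

instance : StarRing (FreeStarAlgebra X) where
  star a := (starHom a).unop
  star_involutive a := by
    refine induction (motive := fun a => (starHom (starHom a).unop).unop = a) ?_ ?_ ?_ ?_ a
    · intro r; simp [starHom_algebraMap]
    · intro x s; simp [starHom_letter]
    · intro a b ha hb; simp [ha, hb]
    · intro a b ha hb; simp [ha, hb]
  star_mul a b := by simp
  star_add a b := by simp

@[simp]
theorem star_letter (x : X) (s : Bool) : star (letter x s) = letter x !s :=
  congrArg MulOpposite.unop (starHom_letter x s)

@[simp]
theorem star_algebraMap (r : ℂ) :
    star (algebraMap ℂ (FreeStarAlgebra X) r) = algebraMap ℂ (FreeStarAlgebra X) (star r) :=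
  congrArg MulOpposite.unop (starHom_algebraMap r)

instance : StarModule ℂ (FreeStarAlgebra X) where
  star_smul r a := by
    rw [Algebra.smul_def, star_mul, star_algebraMap, Algebra.smul_def, Algebra.commutes]

end FreeStarAlgebra

/-! ## C*-seminorms and completions -/

/-- A C*-seminorm on a complex unital `*`-algebra. -/
structure CStarSeminorm (A : Type) [Ring A] [StarRing A] [Algebra ℂ A] where
  toFun : A → ℝ
  nonneg : ∀ a, 0 ≤ toFun a
  add_le : ∀ a b, toFun (a + b) ≤ toFun a + toFun b
  smul : ∀ (c : ℂ) a, toFun (c • a) = ‖c‖ * toFun a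
  mul_le : ∀ a b, toFun (a * b) ≤ toFun a * toFun b
  star_mul_self : ∀ a, toFun (star a * a) = toFun a * toFun a

namespace CStarSeminorm

variable {A : Type} [Ring A] [StarRing A] [Algebra ℂ A]

instance : CoeFun (CStarSeminorm A) fun _ => A → ℝ := ⟨toFun⟩

theorem map_zero (p : CStarSeminorm A) : p 0 = 0 := by
  simpa using p.smul 0 0

theorem map_neg (p : CStarSeminorm A) (a : A) : p (-a) = p a := by
  simpa using p.smul (-1) a

theorem map_one_le (p : CStarSeminorm A) : p 1 ≤ 1 := by
  have h := p.star_mul_self 1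
  rw [star_one, one_mul] at h
  nlinarith [p.nonneg 1]

theorem le_map_star (p : CStarSeminorm A) (a : A) : p a ≤ p (star a) := by
  have h := p.mul_le (star a) a
  rw [p.star_mul_self] at h
  rcases (p.nonneg a).eq_or_lt with h0 | h0
  · rw [← h0]; exact p.nonneg _
  · exact le_of_mul_le_mul_right h h0

theorem map_star (p : CStarSeminorm A) (a : A) : p (star a) = p a :=
  le_antisymm (by simpa using p.le_map_star (star a)) (p.le_map_star a)

open scoped Pointwise in
/-- The pointwise supremum of a pointwise bounded set of C*-seminorms. -/
def sup (S : Set (CStarSeminorm A)) (hS : ∀ a, BddAbove ((fun p : CStarSeminorm A => p a) '' S)) :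
    CStarSeminorm A :=
  have h0 : ∀ a, 0 ≤ sSup ((fun p : CStarSeminorm A => p a) '' S) := fun a =>
    Real.sSup_nonneg (by rintro _ ⟨p, -, rfl⟩; exact p.nonneg a)
  have h1 : ∀ a, ∀ p ∈ S, p a ≤ sSup ((fun p : CStarSeminorm A => p a) '' S) := fun a p hp =>
    le_csSup (hS a) ⟨p, hp, rfl⟩
  { toFun := fun a => sSup ((fun p : CStarSeminorm A => p a) '' S)
    nonneg := h0
    add_le := fun a b => by
      refine Real.sSup_le ?_ (add_nonneg (h0 a) (h0 b))
      rintro _ ⟨p, hp, rfl⟩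
      exact (p.add_le a b).trans (add_le_add (h1 a p hp) (h1 b p hp))
    smul := fun c a => by
      have h : (fun p : CStarSeminorm A => p (c • a)) '' S =
          ‖c‖ • ((fun p : CStarSeminorm A => p a) '' S) := by
        ext x
        simp [Set.mem_smul_set, CStarSeminorm.smul]
      rw [h, Real.sSup_smul_of_nonneg (norm_nonneg c), smul_eq_mul]
    mul_le := fun a b => by
      refine Real.sSup_le ?_ (mul_nonneg (h0 a) (h0 b))
      rintro _ ⟨p, hp, rfl⟩
      exact (p.mul_le a b).trans (mul_le_mul (h1 a p hp) (h1 b p hp) (p.nonneg b) (h0 a))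
    star_mul_self := fun a => by
      apply le_antisymm
      · refine Real.sSup_le ?_ (mul_nonneg (h0 a) (h0 a))
        rintro _ ⟨p, hp, rfl⟩
        simp only [p.star_mul_self]
        exact mul_self_le_mul_self (p.nonneg a) (h1 a p hp)
      · have h2 : sSup ((fun p : CStarSeminorm A => p a) '' S) ≤
            √(sSup ((fun p : CStarSeminorm A => p (star a * a)) '' S)) := by
          refine Real.sSup_le ?_ (Real.sqrt_nonneg _)
          rintro _ ⟨p, hp, rfl⟩
          refine Real.le_sqrt_of_sq_le ?_
          rw [sq, ← p.star_mul_self]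
          exact h1 _ p hp
        calc _ ≤ _ := mul_self_le_mul_self (h0 a) h2
          _ = _ := Real.mul_self_sqrt (h0 _) }

theorem le_sup (S : Set (CStarSeminorm A))
    (hS : ∀ a, BddAbove ((fun p : CStarSeminorm A => p a) '' S)) {p : CStarSeminorm A} (hp : p ∈ S)
    (a : A) : p a ≤ sup S hS a :=
  le_csSup (hS a) ⟨p, hp, rfl⟩

/-- The algebra `A`, regarded as a seminormed algebra by means of the C*-seminorm `p`. -/
def Pre (_p : CStarSeminorm A) : Type := A

variable (p : CStarSeminorm A)

instance : Ring p.Pre := inferInstanceAs (Ring A)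
instance : StarRing p.Pre := inferInstanceAs (StarRing A)
instance : Algebra ℂ p.Pre := inferInstanceAs (Algebra ℂ A)
instance [StarModule ℂ A] : StarModule ℂ p.Pre := inferInstanceAs (StarModule ℂ A)

instance : SeminormedAddCommGroup p.Pre :=
  AddGroupSeminorm.toSeminormedAddCommGroup
    { toFun := p.toFun
      map_zero' := p.map_zero
      add_le' := p.add_le
      neg' := p.map_neg }

instance : SeminormedRing p.Pre where
  __ := (inferInstance : SeminormedAddCommGroup p.Pre)
  __ := (inferInstance : Ring p.Pre)
  norm_mul_le := p.mul_le

instance : NormedAlgebra ℂ p.Pre where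
  norm_smul_le c a := (p.smul c a).le

instance : NormedStarGroup p.Pre where
  norm_star_le a := (p.map_star a).le

/-- The C*-algebra obtained from `A` by separation and completion with respect to the
C*-seminorm `p`. -/
abbrev Completion : Type := UniformSpace.Completion p.Pre

namespace Completion

/-- The canonical map from `A` to its completion. -/
def of (a : A) : p.Completion := UniformSpace.Completion.coe' (α := p.Pre) a

instance : NormedAlgebra ℂ p.Completion where
  __ := (inferInstance : Algebra ℂ (UniformSpace.Completion p.Pre))
  norm_smul_le c a := norm_smul_le (β := UniformSpace.Completion p.Pre) c a

theorem norm_of (a : A) : ‖of p a‖ = p a := UniformSpace.Completion.norm_coe (E := p.Pre) a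

theorem of_mul (a b : A) : of p (a * b) = of p a * of p b :=
  UniformSpace.Completion.coe_mul (α := p.Pre) a b

theorem of_add (a b : A) : of p (a + b) = of p a + of p b :=
  UniformSpace.Completion.coe_add (α := p.Pre) a b

theorem of_smul (c : ℂ) (a : A) : of p (c • a) = c • of p a :=
  UniformSpace.Completion.coe_smul (M := ℂ) (X := p.Pre) c a

theorem of_one : of p 1 = 1 := UniformSpace.Completion.coe_one p.Pre

theorem denseRange_of : DenseRange (of p) := UniformSpace.Completion.denseRange_coe (α := p.Pre)

theorem uniformContinuous_star : UniformContinuous (star : p.Pre → p.Pre) :=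
  (starₗᵢ ℤ (E := p.Pre)).isometry.uniformContinuous

instance : Star p.Completion :=
  ⟨UniformSpace.Completion.map (star : p.Pre → p.Pre)⟩

theorem continuous_star : Continuous (star : p.Completion → p.Completion) :=
  UniformSpace.Completion.continuous_map

theorem of_star (a : A) : of p (star a) = star (of p a) :=
  (UniformSpace.Completion.map_coe (uniformContinuous_star p) a).symm

@[elab_as_elim]
theorem induction {motive : p.Completion → Prop} (closed : IsClosed {x | motive x})
    (of : ∀ a, motive (of p a)) (x : p.Completion) : motive x :=
  UniformSpace.Completion.induction_on x closed of

@[elab_as_elim]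
theorem induction₂ {q : CStarSeminorm A} {motive : p.Completion → q.Completion → Prop}
    (closed : IsClosed {x : p.Completion × q.Completion | motive x.1 x.2})
    (of : ∀ a b, motive (of p a) (of q b)) (x : p.Completion) (y : q.Completion) : motive x y :=
  UniformSpace.Completion.induction_on₂ x y closed of

instance : StarRing p.Completion where
  star_involutive x := by
    have h := continuous_star p
    refine induction p (isClosed_eq (by fun_prop) (by fun_prop)) (fun a => ?_) x
    rw [← of_star, ← of_star, _root_.star_star]
  star_mul x y := by
    have h := continuous_star p
    refine induction₂ p (isClosed_eq (by fun_prop) (by fun_prop)) (fun a b => ?_) x y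
    simp only [← of_star, ← of_mul, StarMul.star_mul]
  star_add x y := by
    have h := continuous_star p
    refine induction₂ p (isClosed_eq (by fun_prop) (by fun_prop)) (fun a b => ?_) x y
    simp only [← of_star, ← of_add, StarAddMonoid.star_add]

instance : CStarRing p.Completion where
  norm_mul_self_le x := by
    have h := continuous_star p
    refine induction p (isClosed_le (by fun_prop) (by fun_prop)) (fun a => ?_) x
    rw [← of_star, ← of_mul, norm_of, norm_of, p.star_mul_self]

variable [StarModule ℂ A]

instance : StarModule ℂ p.Completion where
  star_smul c x := by
    have h := continuous_star p
    have h1 : ∀ c : ℂ, Continuous fun x : p.Completion => c • x := fun c => continuous_const_smul c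
    refine induction p (isClosed_eq (h.comp (h1 c)) ((h1 (star c)).comp h)) (fun a => ?_) x
    rw [← of_smul, ← of_star, ← of_star, ← of_smul, StarModule.star_smul]

instance : CStarAlgebra p.Completion where

/-- The canonical map from `A` to its completion, as a `*`-homomorphism. -/
def ofHom : A →⋆ₐ[ℂ] p.Completion where
  toFun := of p
  map_one' := of_one p
  map_mul' := of_mul p
  map_zero' := by simpa using of_smul p 0 0
  map_add' := of_add p
  commutes' c := by rw [Algebra.algebraMap_eq_smul_one, of_smul, of_one,
    Algebra.algebraMap_eq_smul_one]
  map_star' := of_star p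

/-- The extension by continuity of a `*`-homomorphism which decreases C*-seminorms. -/
def map {B : Type} [Ring B] [StarRing B] [Algebra ℂ B] [StarModule ℂ B] {p : CStarSeminorm A}
    {q : CStarSeminorm B} (f : A →⋆ₐ[ℂ] B) (hf : ∀ a, q (f a) ≤ p a) :
    p.Completion →⋆ₐ[ℂ] q.Completion :=
  have hu : UniformContinuous (α := p.Pre) (β := q.Pre) f :=
    (AddMonoidHomClass.lipschitz_of_bound (E := p.Pre) (F := q.Pre) (f : A →+ B) 1
      (fun a => by rw [one_mul]; exact hf a)).uniformContinuous
  have hc : Continuous (UniformSpace.Completion.map (α := p.Pre) (β := q.Pre) f :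
      p.Completion → q.Completion) := UniformSpace.Completion.continuous_map
  have ho : ∀ a, (UniformSpace.Completion.map (α := p.Pre) (β := q.Pre) f :
      p.Completion → q.Completion) (of p a) = of q (f a) := fun a =>
    UniformSpace.Completion.map_coe hu a
  have hsp := continuous_star p
  have hsq := continuous_star q
  { toFun := UniformSpace.Completion.map (α := p.Pre) (β := q.Pre) f
    map_one' := by rw [← of_one, ho, map_one, of_one]
    map_mul' := fun x y => by
      refine induction₂ p (isClosed_eq (by fun_prop) (by fun_prop)) (fun a b => ?_) x y
      simp only [← of_mul, ho, map_mul]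
    map_zero' := by
      have h : of p 0 = 0 := (ofHom p).map_zero'
      have h' : of q 0 = 0 := (ofHom q).map_zero'
      rw [← h, ho, _root_.map_zero, h']
    map_add' := fun x y => by
      refine induction₂ p (isClosed_eq (by fun_prop) (by fun_prop)) (fun a b => ?_) x y
      simp only [← of_add, ho, map_add]
    commutes' := fun c => by
      rw [Algebra.algebraMap_eq_smul_one, Algebra.algebraMap_eq_smul_one, ← of_one, ← of_smul, ho,
        map_smul, map_one, of_smul, of_one]
    map_star' := fun x => by
      refine induction p (isClosed_eq (by fun_prop) (by fun_prop)) (fun a => ?_) x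
      simp only [← of_star, ho, StarHomClass.map_star] }

theorem map_of {B : Type} [Ring B] [StarRing B] [Algebra ℂ B] [StarModule ℂ B]
    {p : CStarSeminorm A} {q : CStarSeminorm B} (f : A →⋆ₐ[ℂ] B) (hf : ∀ a, q (f a) ≤ p a) (a : A) :
    map f hf (of p a) = of q (f a) :=
  UniformSpace.Completion.map_coe (α := p.Pre) (β := q.Pre)
    (AddMonoidHomClass.lipschitz_of_bound (E := p.Pre) (F := q.Pre) (f : A →+ B) 1
      (fun a => by rw [one_mul]; exact hf a)).uniformContinuous a

end Completion

end CStarSeminorm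

/-! ## The minimal tensor product of C*-algebras -/

section MinTensor

variable {A B C A' B' : Type} [CStarAlgebra A] [CStarAlgebra B] [CStarAlgebra C]
  [CStarAlgebra A'] [CStarAlgebra B']

section Representation

variable {H K : Type} [NormedAddCommGroup H] [InnerProductSpace ℂ H] [CompleteSpace H]
  [NormedAddCommGroup K] [InnerProductSpace ℂ K] [CompleteSpace K]

/-- The algebra of bounded operators on a complex inner product space. -/
abbrev BoundedOp (E : Type) [NormedAddCommGroup E] [InnerProductSpace ℂ E] : Type := E →L[ℂ] E

/-- A homomorphism `φ` from a `*`-algebra to the bounded operators on a complex inner product space,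
with `φ(x^*)` adjoint to `φ(x)`, defines the C*-seminorm `x ↦ ‖φ(x)‖`. -/
def operatorSeminorm {D E : Type} [Ring D] [StarRing D] [Algebra ℂ D] [NormedAddCommGroup E]
    [InnerProductSpace ℂ E] (φ : D →ₐ[ℂ] BoundedOp E)
    (hφ : ∀ x ξ η, inner ℂ (φ x ξ) η = inner ℂ ξ (φ (star x) η)) : CStarSeminorm D :=
  have hmul : ∀ x y : D, ‖φ (x * y)‖ ≤ ‖φ x‖ * ‖φ y‖ := fun x y => by
    rw [map_mul]; exact norm_mul_le _ _
  have hsq : ∀ x : D, ‖φ x‖ * ‖φ x‖ ≤ ‖φ (star x * x)‖ := fun x => by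
    have h : ‖φ x‖ ≤ √‖φ (star x * x)‖ := by
      refine ContinuousLinearMap.opNorm_le_bound _ (Real.sqrt_nonneg _) fun ξ => ?_
      have h1 : ‖φ x ξ‖ ^ 2 ≤ ‖φ (star x * x)‖ * ‖ξ‖ ^ 2 :=
        calc ‖φ x ξ‖ ^ 2
            = ‖(inner ℂ (φ x ξ) (φ x ξ) : ℂ)‖ := by
              rw [inner_self_eq_norm_sq_to_K]; simp
          _ = ‖(inner ℂ ξ (φ (star x * x) ξ) : ℂ)‖ := by
              rw [hφ, map_mul]; rfl
          _ ≤ ‖ξ‖ * ‖φ (star x * x) ξ‖ := norm_inner_le_norm _ _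
          _ ≤ ‖ξ‖ * (‖φ (star x * x)‖ * ‖ξ‖) := by
              gcongr; exact ContinuousLinearMap.le_opNorm _ _
          _ = _ := by ring
      calc ‖φ x ξ‖ = √(‖φ x ξ‖ ^ 2) := (Real.sqrt_sq (norm_nonneg _)).symm
        _ ≤ √(‖φ (star x * x)‖ * ‖ξ‖ ^ 2) := Real.sqrt_le_sqrt h1
        _ = _ := by rw [Real.sqrt_mul (norm_nonneg _), Real.sqrt_sq (norm_nonneg _)]
    calc _ ≤ _ := mul_self_le_mul_self (norm_nonneg _) h
      _ = _ := Real.mul_self_sqrt (norm_nonneg _)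
  have hstar : ∀ x : D, ‖φ x‖ ≤ ‖φ (star x)‖ := fun x => by
    rcases (norm_nonneg (φ x)).eq_or_lt with h0 | h0
    · rw [← h0]; exact norm_nonneg _
    · exact le_of_mul_le_mul_right ((hsq x).trans (hmul _ _)) h0
  { toFun := fun x => ‖φ x‖
    nonneg := fun x => norm_nonneg _
    add_le := fun x y => by rw [map_add]; exact norm_add_le _ _
    smul := fun c x => by rw [map_smul, norm_smul]
    mul_le := hmul
    star_mul_self := fun x => le_antisymm
      ((hmul _ _).trans (mul_le_mul_of_nonneg_right (by simpa using hstar (star x))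
        (norm_nonneg _))) (hsq x) }

/-- For representations `π` and `ρ` of `A` and `B` on Hilbert spaces `H` and `K`, the
representation `a ⊗ b ↦ π(a) ⊗ ρ(b)` of the algebraic tensor product by bounded operators on the
(algebraic, hence dense) tensor product of `H` and `K`. -/
def tensorRep (π : A →⋆ₐ[ℂ] (H →L[ℂ] H)) (ρ : B →⋆ₐ[ℂ] (K →L[ℂ] K)) :
    A ⊗[ℂ] B →ₐ[ℂ] BoundedOp (H ⊗[ℂ] K) :=
  Algebra.TensorProduct.lift
    (AlgHom.ofLinearMap
      { toFun := fun a => TensorProduct.mapL (π a) (1 : K →L[ℂ] K)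
        map_add' := fun a b => by rw [map_add, TensorProduct.mapL_add_left]
        map_smul' := fun c a => by rw [map_smul, TensorProduct.mapL_smul_left]; rfl }
      (by simp [ContinuousLinearMap.one_def])
      (fun a b => by
        simp only [LinearMap.coe_mk, AddHom.coe_mk]
        rw [← TensorProduct.mapL_mul, map_mul, one_mul]))
    (AlgHom.ofLinearMap
      { toFun := fun b => TensorProduct.mapL (1 : H →L[ℂ] H) (ρ b)
        map_add' := fun a b => by rw [map_add, TensorProduct.mapL_add_right]
        map_smul' := fun c a => by rw [map_smul, TensorProduct.mapL_smul_right]; rfl }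
      (by simp [ContinuousLinearMap.one_def])
      (fun a b => by
        simp only [LinearMap.coe_mk, AddHom.coe_mk]
        rw [← TensorProduct.mapL_mul, map_mul, one_mul]))
    (fun a b => by
      simp only [Commute, SemiconjBy, AlgHom.ofLinearMap_apply, LinearMap.coe_mk, AddHom.coe_mk]
      rw [← TensorProduct.mapL_mul, ← TensorProduct.mapL_mul]
      simp)

theorem tensorRep_tmul (π : A →⋆ₐ[ℂ] (H →L[ℂ] H)) (ρ : B →⋆ₐ[ℂ] (K →L[ℂ] K)) (a : A) (b : B) :
    tensorRep π ρ (a ⊗ₜ b) = TensorProduct.mapL (π a) (ρ b) := by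
  rw [tensorRep, Algebra.TensorProduct.lift_tmul]
  simp only [AlgHom.ofLinearMap_apply, LinearMap.coe_mk, AddHom.coe_mk]
  rw [← TensorProduct.mapL_mul, one_mul, mul_one]

theorem inner_tensorRep (π : A →⋆ₐ[ℂ] (H →L[ℂ] H)) (ρ : B →⋆ₐ[ℂ] (K →L[ℂ] K)) (x : A ⊗[ℂ] B)
    (ξ η : H ⊗[ℂ] K) :
    inner ℂ (tensorRep π ρ x ξ) η = inner ℂ ξ (tensorRep π ρ (star x) η) := by
  induction x with
  | zero => simp
  | add x y hx hy => simp [hx, hy, inner_add_left, inner_add_right]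
  | tmul a b =>
    rw [TensorProduct.star_tmul, tensorRep_tmul, tensorRep_tmul]
    induction ξ with
    | zero => simp
    | add ξ ξ' h h' => rw [map_add, inner_add_left, h, h', inner_add_left]
    | tmul h k =>
      induction η with
      | zero => simp
      | add η η' h h' => rw [map_add, inner_add_right, h, h', inner_add_right]
      | tmul h' k' =>
        rw [TensorProduct.mapL_tmul, TensorProduct.mapL_tmul, TensorProduct.inner_tmul,
          TensorProduct.inner_tmul, map_star, map_star, ContinuousLinearMap.star_eq_adjoint,
          ContinuousLinearMap.star_eq_adjoint, ContinuousLinearMap.adjoint_inner_right,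
          ContinuousLinearMap.adjoint_inner_right]

/-- The C*-seminorm `x ↦ ‖(π ⊗ ρ)(x)‖` on the algebraic tensor product. -/
def tensorRepSeminorm (π : A →⋆ₐ[ℂ] (H →L[ℂ] H)) (ρ : B →⋆ₐ[ℂ] (K →L[ℂ] K)) :
    CStarSeminorm (A ⊗[ℂ] B) :=
  operatorSeminorm (tensorRep π ρ) (inner_tensorRep π ρ)

end Representation

/-- The set of the C*-seminorms `x ↦ ‖(π ⊗ ρ)(x)‖`, for all representations `π` of `A` and `ρ` of `B`
on Hilbert spaces. -/
def spatialSeminorms (A B : Type) [CStarAlgebra A] [CStarAlgebra B] :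
    Set (CStarSeminorm (A ⊗[ℂ] B)) :=
  {p | ∃ (H K : Type) (_ : NormedAddCommGroup H) (_ : InnerProductSpace ℂ H)
    (_ : CompleteSpace H) (_ : NormedAddCommGroup K) (_ : InnerProductSpace ℂ K)
    (_ : CompleteSpace K) (π : A →⋆ₐ[ℂ] (H →L[ℂ] H)) (ρ : B →⋆ₐ[ℂ] (K →L[ℂ] K)),
    p = tensorRepSeminorm π ρ}

theorem spatialSeminorms_bounded (x : A ⊗[ℂ] B) :
    BddAbove ((fun p : CStarSeminorm (A ⊗[ℂ] B) => p x) '' spatialSeminorms A B) := by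
  suffices h : ∃ M, ∀ p ∈ spatialSeminorms A B, p x ≤ M by
    obtain ⟨M, hM⟩ := h
    exact ⟨M, by rintro _ ⟨p, hp, rfl⟩; exact hM p hp⟩
  induction x with
  | zero => exact ⟨0, fun p _ => p.map_zero.le⟩
  | add x y hx hy =>
    obtain ⟨M, hM⟩ := hx
    obtain ⟨M', hM'⟩ := hy
    exact ⟨M + M', fun p hp => (p.add_le x y).trans (add_le_add (hM p hp) (hM' p hp))⟩
  | tmul a b =>
    refine ⟨‖a‖ * ‖b‖, ?_⟩
    rintro _ ⟨H, K, _, _, _, _, _, _, π, ρ, rfl⟩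
    change ‖tensorRep π ρ (a ⊗ₜ b)‖ ≤ _
    rw [tensorRep_tmul]
    exact (TensorProduct.norm_mapL_le _ _).trans
      (mul_le_mul (NonUnitalStarAlgHom.norm_apply_le π a)
        (NonUnitalStarAlgHom.norm_apply_le ρ b) (norm_nonneg _) (norm_nonneg _))

/-- The minimal (spatial) C*-norm on the algebraic tensor product of two C*-algebras:
`‖x‖ = sup ‖(π ⊗ ρ)(x)‖` over all representations `π` of `A` and `ρ` of `B` on Hilbert spaces. -/
def minSeminorm (A B : Type) [CStarAlgebra A] [CStarAlgebra B] : CStarSeminorm (A ⊗[ℂ] B) :=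
  CStarSeminorm.sup (spatialSeminorms A B) spatialSeminorms_bounded

theorem le_minSeminorm {H K : Type} [NormedAddCommGroup H] [InnerProductSpace ℂ H]
    [CompleteSpace H] [NormedAddCommGroup K] [InnerProductSpace ℂ K] [CompleteSpace K]
    (π : A →⋆ₐ[ℂ] (H →L[ℂ] H)) (ρ : B →⋆ₐ[ℂ] (K →L[ℂ] K)) (x : A ⊗[ℂ] B) :
    ‖tensorRep π ρ x‖ ≤ minSeminorm A B x :=
  CStarSeminorm.le_sup (spatialSeminorms A B) spatialSeminorms_bounded
    (p := tensorRepSeminorm π ρ)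
    ⟨H, K, inferInstance, inferInstance, inferInstance, inferInstance, inferInstance,
      inferInstance, π, ρ, rfl⟩ x

/-- The minimal tensor product `A ⊗ B` of two unital C*-algebras. -/
abbrev MinTensor (A B : Type) [CStarAlgebra A] [CStarAlgebra B] : Type :=
  (minSeminorm A B).Completion

namespace MinTensor

/-- The elementary tensor `a ⊗ b`. -/
def tmul (a : A) (b : B) : MinTensor A B := CStarSeminorm.Completion.of (minSeminorm A B) (a ⊗ₜ b)

/-- The `*`-homomorphism `f ⊗ g` between algebraic tensor products. -/
def algMap (f : A →⋆ₐ[ℂ] A') (g : B →⋆ₐ[ℂ] B') : A ⊗[ℂ] B →⋆ₐ[ℂ] A' ⊗[ℂ] B' where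
  __ := Algebra.TensorProduct.map f.toAlgHom g.toAlgHom
  map_star' x := by
    simp only [AlgHom.toRingHom_eq_coe, RingHom.toMonoidHom_eq_coe, OneHom.toFun_eq_coe,
      MonoidHom.toOneHom_coe, MonoidHom.coe_coe, RingHom.coe_coe]
    induction x with
    | zero => simp
    | add x y hx hy => simp [hx, hy]
    | tmul a b =>
      rw [TensorProduct.star_tmul, Algebra.TensorProduct.map_tmul, Algebra.TensorProduct.map_tmul,
        TensorProduct.star_tmul]
      exact congrArg₂ _ (map_star f a) (map_star g b)

/-- The `*`-homomorphism `f ⊗ g` between minimal tensor products. -/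
def map (f : A →⋆ₐ[ℂ] A') (g : B →⋆ₐ[ℂ] B') : MinTensor A B →⋆ₐ[ℂ] MinTensor A' B' :=
  CStarSeminorm.Completion.map (algMap f g) (fun x => by
    refine Real.sSup_le ?_ (CStarSeminorm.nonneg _ x)
    rintro _ ⟨_, ⟨H, K, _, _, _, _, _, _, π, ρ, rfl⟩, rfl⟩
    have h : tensorRep π ρ (algMap f g x) = tensorRep (π.comp f) (ρ.comp g) x := by
      induction x with
      | zero => simp
      | add x y hx hy => simp [hx, hy]
      | tmul a b =>
        rw [tensorRep_tmul]
        exact tensorRep_tmul π ρ (f a) (g b)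
    change ‖tensorRep π ρ (algMap f g x)‖ ≤ _
    rw [h]
    exact le_minSeminorm (π.comp f) (ρ.comp g) x)

theorem map_tmul (f : A →⋆ₐ[ℂ] A') (g : B →⋆ₐ[ℂ] B') (a : A) (b : B) :
    map f g (tmul a b) = tmul (f a) (g b) :=
  CStarSeminorm.Completion.map_of _ _ _

/-- `SameTriple x y` says that `x ∈ (A ⊗ B) ⊗ C` and `y ∈ A ⊗ (B ⊗ C)` represent the same
element of the triple minimal tensor product `A ⊗ B ⊗ C`: the pair `(x, y)` belongs to the graph of
the canonical isometric isomorphism `(A ⊗ B) ⊗ C ≃ A ⊗ (B ⊗ C)`, which is the closure of the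
linear span of the pairs `((a ⊗ b) ⊗ c, a ⊗ (b ⊗ c))`. -/
def SameTriple (x : MinTensor (MinTensor A B) C) (y : MinTensor A (MinTensor B C)) : Prop :=
  (x, y) ∈ closure ((Submodule.span ℂ
    {t : MinTensor (MinTensor A B) C × MinTensor A (MinTensor B C) |
      ∃ a b c, t = (tmul (tmul a b) c, tmul a (tmul b c))} : Submodule ℂ _) :
    Set (MinTensor (MinTensor A B) C × MinTensor A (MinTensor B C)))

end MinTensor

end MinTensor

/-! ## Universal C*-algebras -/

/-- Generators `x ∈ X` and `*`-polynomial relations `a = b`, such that each generator is uniformly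
bounded in norm whenever the relations hold; this is what makes the universal C*-algebra exist. -/
structure CStarPresentation (X : Type) where
  rel : FreeStarAlgebra X → FreeStarAlgebra X → Prop
  bounded : ∀ x, ∃ M : ℝ, ∀ p : CStarSeminorm (FreeStarAlgebra X),
    (∀ a b, rel a b → p (a - b) = 0) → p (FreeStarAlgebra.gen x) ≤ M

namespace CStarPresentation

variable {X : Type} (P : CStarPresentation X)

/-- The C*-seminorms on the free `*`-algebra for which the relations hold. -/
def admissible : Set (CStarSeminorm (FreeStarAlgebra X)) := {p | ∀ a b, P.rel a b → p (a - b) = 0}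

theorem admissible_bounded (a : FreeStarAlgebra X) :
    BddAbove ((fun p : CStarSeminorm (FreeStarAlgebra X) => p a) '' P.admissible) := by
  suffices h : ∃ M, ∀ p ∈ P.admissible, p a ≤ M by
    obtain ⟨M, hM⟩ := h
    exact ⟨M, by rintro _ ⟨p, hp, rfl⟩; exact hM p hp⟩
  induction a using FreeStarAlgebra.induction with
  | scalar r =>
    refine ⟨‖r‖, fun p _ => ?_⟩
    rw [Algebra.algebraMap_eq_smul_one, p.smul]
    nlinarith [p.map_one_le, norm_nonneg r]
  | letter x s =>
    obtain ⟨M, hM⟩ := P.bounded x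
    refine ⟨M, fun p hp => ?_⟩
    cases s with
    | false => exact hM p hp
    | true =>
      have h := hM p hp
      rwa [← p.map_star, FreeStarAlgebra.gen, FreeStarAlgebra.star_letter] at h
  | mul a b ha hb =>
    obtain ⟨M, hM⟩ := ha
    obtain ⟨M', hM'⟩ := hb
    exact ⟨M * M', fun p hp => (p.mul_le a b).trans
      (mul_le_mul (hM p hp) (hM' p hp) (p.nonneg b) ((p.nonneg a).trans (hM p hp)))⟩
  | add a b ha hb =>
    obtain ⟨M, hM⟩ := ha
    obtain ⟨M', hM'⟩ := hb
    exact ⟨M + M', fun p hp => (p.add_le a b).trans (add_le_add (hM p hp) (hM' p hp))⟩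

/-- The largest C*-seminorm on the free `*`-algebra for which the relations hold. -/
def seminorm : CStarSeminorm (FreeStarAlgebra X) :=
  CStarSeminorm.sup P.admissible P.admissible_bounded

/-- The universal C*-algebra `C^*(X | P)`: the completion of the free `*`-algebra for the largest
C*-seminorm for which the relations hold. -/
abbrev Universal : Type := P.seminorm.Completion

/-- The generators of the universal C*-algebra. -/
def gen (x : X) : P.Universal := CStarSeminorm.Completion.of P.seminorm (FreeStarAlgebra.gen x)

end CStarPresentation

/-- If `∑ a_i^* a_i = 1` then `‖a_i‖ ≤ 1`. -/
theorem CStarSeminorm.le_one_of_sum {A ι : Type} [Ring A] [StarRing A] [Algebra ℂ A]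
    [StarModule ℂ A] [Fintype ι] (p : CStarSeminorm A) (a : ι → A)
    (h : p (∑ i, star (a i) * a i - 1) = 0) (i : ι) : p (a i) ≤ 1 := by
  let f := CStarSeminorm.Completion.ofHom p
  have hf : ∀ x, ‖f x‖ = p x := CStarSeminorm.Completion.norm_of p
  have h1 : ∑ i, star (f (a i)) * f (a i) = 1 := by
    rw [← hf, norm_eq_zero, map_sub, sub_eq_zero, map_sum, map_one] at h
    simpa only [map_mul, StarHomClass.map_star] using h
  let _ := CStarAlgebra.spectralOrder p.Completion
  have _ := CStarAlgebra.spectralOrderedRing p.Completion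
  have h2 : star (f (a i)) * f (a i) ≤ 1 := by
    rw [← h1]
    exact Finset.single_le_sum (f := fun i => star (f (a i)) * f (a i))
      (fun j _ => star_mul_self_nonneg (f (a j))) (Finset.mem_univ i)
  have h3 := CStarAlgebra.norm_le_norm_of_nonneg_of_le (star_mul_self_nonneg (f (a i))) h2
  rw [← map_one f, hf, CStarRing.norm_star_mul_self, hf] at h3
  nlinarith [p.map_one_le, p.nonneg (a i)]

/-! ## The ten spheres and the ten quantum groups -/

/-- The real case (spheres over `ℝ`, subgroups of `O_N^+`) and the complex case (spheres over `ℂ`,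
subgroups of `U_N^+`). -/
inductive Ground
  | real
  | complex

/-- The five columns: classical, half-classical (`*` or `**`), free (`+`), and the twists (denoted
with a bar) of the half-classical and of the classical case. -/
inductive Kind
  | classical
  | halfClassical
  | free
  | twistedHalfClassical
  | twisted

open FreeStarAlgebra in
/-- The commutation relations of the given kind between the generators `a, b, c, … ∈ X`, where
`α ∈ {a, a^*}`, `β ∈ {b, b^*}`, `γ ∈ {c, c^*}` are arbitrary, and where the signs in the twisted
cases are prescribed by `σ₂` and `σ₃`. There are no relations in the free case. -/
inductive CommutationRel {X : Type} (σ₂ : X → X → ℤ) (σ₃ : X → X → X → ℤ) :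
    Kind → FreeStarAlgebra X → FreeStarAlgebra X → Prop
  | classical (a b : X) (s t : Bool) : CommutationRel σ₂ σ₃ .classical
      (letter a s * letter b t) (letter b t * letter a s)
  | halfClassical (a b c : X) (s t r : Bool) : CommutationRel σ₂ σ₃ .halfClassical
      (letter a s * letter b t * letter c r) (letter c r * letter b t * letter a s)
  | twistedHalfClassical (a b c : X) (s t r : Bool) : CommutationRel σ₂ σ₃ .twistedHalfClassical
      (letter a s * letter b t * letter c r) (σ₃ a b c • (letter c r * letter b t * letter a s))
  | twisted (a b : X) (s t : Bool) : CommutationRel σ₂ σ₃ .twisted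
      (letter a s * letter b t) (σ₂ a b • (letter b t * letter a s))

/-- Coordinates of twisted spheres anticommute when distinct. -/
def sphereSign₂ {N : ℕ} (a b : Fin N) : ℤ := if a ≠ b then -1 else 1

/-- The sign in `αβγ = ± γβα` for twisted half-classical spheres: `-` when `a, b, c` are distinct. -/
def sphereSign₃ {N : ℕ} (a b c : Fin N) : ℤ := if a ≠ b ∧ a ≠ c ∧ b ≠ c then -1 else 1

/-- Coordinates `u_a`, `u_b` of twisted quantum groups anticommute when they are distinct, and on
the same row or column. -/
def groupSign₂ {N : ℕ} (a b : Fin N × Fin N) : ℤ :=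
  if a ≠ b ∧ (a.1 = b.1 ∨ a.2 = b.2) then -1 else 1

/-- The sign in `αβγ = ± γβα` for twisted half-classical quantum groups: `-` when the numbers
`(r, c)` of rows and columns spanned by the coordinates are `(≤ 2, 3)` or `(3, ≤ 2)`. -/
def groupSign₃ {N : ℕ} (a b c : Fin N × Fin N) : ℤ :=
  let rows := ({a.1, b.1, c.1} : Finset (Fin N)).card
  let cols := ({a.2, b.2, c.2} : Finset (Fin N)).card
  if (rows ≤ 2 ∧ cols = 3) ∨ (rows = 3 ∧ cols ≤ 2) then -1 else 1

open FreeStarAlgebra in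
/-- The relations between the coordinates `z_1, …, z_N` of a sphere. -/
inductive SphereRel (𝕂 : Ground) (t : Kind) (N : ℕ) :
    FreeStarAlgebra (Fin N) → FreeStarAlgebra (Fin N) → Prop
  | sum_mul_star : SphereRel 𝕂 t N (∑ i, gen i * star (gen i)) 1
  | sum_star_mul : SphereRel 𝕂 t N (∑ i, star (gen i) * gen i) 1
  | real (h : 𝕂 = .real) (i : Fin N) : SphereRel 𝕂 t N (gen i) (star (gen i))
  | comm (a b : FreeStarAlgebra (Fin N)) (h : CommutationRel sphereSign₂ sphereSign₃ t a b) :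
      SphereRel 𝕂 t N a b

open FreeStarAlgebra in
/-- The relations between the coordinates `u_ij` of a quantum group: `u` is biunitary
(`u u^* = u^* u = 1` and `u^t ū = ū u^t = 1`), with self-adjoint entries in the real case, and its
entries satisfy the commutation relations of the given kind. -/
inductive GroupRel (𝕂 : Ground) (t : Kind) (N : ℕ) :
    FreeStarAlgebra (Fin N × Fin N) → FreeStarAlgebra (Fin N × Fin N) → Prop
  | mul_adjoint (i j : Fin N) :
      GroupRel 𝕂 t N (∑ k, gen (i, k) * star (gen (j, k))) (if i = j then 1 else 0)
  | adjoint_mul (i j : Fin N) :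
      GroupRel 𝕂 t N (∑ k, star (gen (k, i)) * gen (k, j)) (if i = j then 1 else 0)
  | transpose_mul_conj (i j : Fin N) :
      GroupRel 𝕂 t N (∑ k, gen (k, i) * star (gen (k, j))) (if i = j then 1 else 0)
  | conj_mul_transpose (i j : Fin N) :
      GroupRel 𝕂 t N (∑ k, star (gen (i, k)) * gen (j, k)) (if i = j then 1 else 0)
  | real (h : 𝕂 = .real) (i j : Fin N) : GroupRel 𝕂 t N (gen (i, j)) (star (gen (i, j)))
  | comm (a b : FreeStarAlgebra (Fin N × Fin N))
      (h : CommutationRel groupSign₂ groupSign₃ t a b) : GroupRel 𝕂 t N a b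

/-- The presentation of the algebra of a sphere. -/
def spherePresentation (𝕂 : Ground) (t : Kind) (N : ℕ) : CStarPresentation (Fin N) where
  rel := SphereRel 𝕂 t N
  bounded i := ⟨1, fun p hp => p.le_one_of_sum _ (hp _ _ .sum_star_mul) i⟩

/-- The presentation of the algebra of a quantum group. -/
def groupPresentation (𝕂 : Ground) (t : Kind) (N : ℕ) : CStarPresentation (Fin N × Fin N) where
  rel := GroupRel 𝕂 t N
  bounded x := ⟨1, fun p hp => p.le_one_of_sum (fun k => FreeStarAlgebra.gen (k, x.2))
    (by simpa using hp _ _ (.adjoint_mul x.2 x.2)) x.1⟩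

/-- The C*-algebra `C(S^{N-1}_×)` of one of the ten spheres. -/
abbrev CSphere (𝕂 : Ground) (t : Kind) (N : ℕ) : Type := (spherePresentation 𝕂 t N).Universal

/-- The C*-algebra `C(U_N^×)` of one of the ten quantum groups. -/
abbrev CGroup (𝕂 : Ground) (t : Kind) (N : ℕ) : Type := (groupPresentation 𝕂 t N).Universal

/-- The standard coordinate `z_i ∈ C(S^{N-1}_×)`. -/
def sphereCoord (𝕂 : Ground) (t : Kind) {N : ℕ} (i : Fin N) : CSphere 𝕂 t N :=
  (spherePresentation 𝕂 t N).gen i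

/-- The standard coordinate `u_ij ∈ C(U_N^×)`. -/
def groupCoord (𝕂 : Ground) (t : Kind) {N : ℕ} (i j : Fin N) : CGroup 𝕂 t N :=
  (groupPresentation 𝕂 t N).gen (i, j)

/-! ## Actions -/

/-- Let `Δ : C(G) → C(G) ⊗ C(G)` and `ε : C(G) → ℂ` be the comultiplication and the counit of a
quantum group. A morphism `Φ : C(X) → C(G) ⊗ C(X)` is an action of `G` on `X` when it satisfies the
coassociativity, counitality and faithfulness axioms. -/
structure IsQuantumGroupAction {G X : Type} [CStarAlgebra G] [CStarAlgebra X]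
    (Δ : G →⋆ₐ[ℂ] MinTensor G G) (ε : G →⋆ₐ[ℂ] ℂ) (Φ : X →⋆ₐ[ℂ] MinTensor G X) : Prop where
  /-- `(Δ ⊗ id)Φ = (id ⊗ Φ)Φ` in `C(G) ⊗ C(G) ⊗ C(X)`. -/
  coassoc : ∀ x, MinTensor.SameTriple (MinTensor.map Δ (StarAlgHom.id ℂ X) (Φ x))
    (MinTensor.map (StarAlgHom.id ℂ G) Φ (Φ x))
  /-- `(ε ⊗ id)Φ = id`, with `C(X)` identified with `ℂ ⊗ C(X)` by `x ↦ 1 ⊗ x`. -/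
  counit : ∀ x, MinTensor.map ε (StarAlgHom.id ℂ X) (Φ x) = MinTensor.tmul 1 x
  /-- The linear span of the products `Φ(x)(a ⊗ 1)` is dense in `C(G) ⊗ C(X)`. -/
  dense : Dense ((Submodule.span ℂ
    {y : MinTensor G X | ∃ x a, y = Φ x * MinTensor.tmul a 1} : Submodule ℂ (MinTensor G X)) :
      Set (MinTensor G X))

end

open scoped TensorProduct

noncomputable section

/-! All three maps come from the universal property: a family in a C*-algebra that satisfies the
relations extends to a `*`-homomorphism (`CStarPresentation.lift`). What has to be checked is that
$\sum_k u_{ik}\otimes u_{kj}$, $\delta_{ij}$ and $\sum_j u_{ij}\otimes z_j$ satisfy the relations.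

Biunitarity and the sphere equation follow by contracting one tensor leg first (`IsBiunitary.tmul`,
`IsBiunitary.sum_adj_tmul`). For the commutation relations, both sides expand into sums of
elementary tensors that match term by term up to the product of the signs of the two legs
(`CommutationRel.lift_eq`). That product must not depend on the summation indices. It does not,
because each group sign is the sphere sign of the row indices times the sphere sign of the column
indices: the summation indices occur in both legs, so their sphere sign appears squared and
disappears.

Coassociativity and counitality compare two `*`-homomorphisms, and the set where they agree is a
closed subalgebra, so generators and their adjoints suffice (`CStarPresentation.mem_of_isClosed`).
Density rests on the inversion formula $\sum_j\Phi(z_j)(u_{ji}^*\otimes1)=1\otimes z_i$ and its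
adjoint variant (`sum_sphereAction_adj_mul`), together with the fact that the two tensor legs
commute. -/

/-- The element `b` (for `s = false`) or `b^*` (for `s = true`). -/
def adj {B : Type} [Star B] (b : B) (s : Bool) : B := if s then star b else b

section adj

variable {B : Type} [CStarAlgebra B]

theorem adj_not (b : B) (s : Bool) : adj b (!s) = star (adj b s) := by
  cases s <;> simp [adj]

theorem adj_sum {ι : Type} (t : Finset ι) (b : ι → B) (s : Bool) :
    adj (∑ i ∈ t, b i) s = ∑ i ∈ t, adj (b i) s := by
  cases s <;> simp [adj]

theorem map_adj {C : Type} [CStarAlgebra C] (f : B →⋆ₐ[ℂ] C) (b : B) (s : Bool) :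
    f (adj b s) = adj (f b) s := by
  cases s <;> simp [adj, map_star]

end adj

/-! ### Universal properties of the free `*`-algebra, of completions and of presentations. -/

namespace FreeStarAlgebra

variable {X B : Type} [CStarAlgebra B]

/-- The `*`-homomorphism on the free `*`-algebra with prescribed values at the generators. -/
def lift (f : X → B) : FreeStarAlgebra X →⋆ₐ[ℂ] B :=
  let g : FreeStarAlgebra X →ₐ[ℂ] B := FreeAlgebra.lift ℂ fun x : X × Bool => adj (f x.1) x.2
  have hg : ∀ x s, g (letter x s) = adj (f x) s := fun x s =>
    FreeAlgebra.lift_ι_apply (fun x : X × Bool => adj (f x.1) x.2) (x, s)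
  { g with
    map_star' := fun a => by
      change g (star a) = star (g a)
      induction a using FreeStarAlgebra.induction with
      | scalar r => rw [star_algebraMap, AlgHom.commutes, AlgHom.commutes, algebraMap_star_comm]
      | letter x s => rw [star_letter, hg, hg, adj_not]
      | mul a b ha hb => rw [star_mul, map_mul, ha, hb, map_mul, star_mul]
      | add a b ha hb => rw [star_add, map_add, ha, hb, map_add, star_add] }

theorem lift_letter (f : X → B) (x : X) (s : Bool) : lift f (letter x s) = adj (f x) s :=
  FreeAlgebra.lift_ι_apply (fun x : X × Bool => adj (f x.1) x.2) (x, s)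

theorem lift_gen (f : X → B) (x : X) : lift f (gen x) = f x := lift_letter f x false

end FreeStarAlgebra

/-- The C*-seminorm `a ↦ ‖f a‖` attached to a `*`-homomorphism into a C*-algebra. -/
def CStarSeminorm.ofStarAlgHom {A B : Type} [Ring A] [StarRing A] [Algebra ℂ A] [CStarAlgebra B]
    (f : A →⋆ₐ[ℂ] B) : CStarSeminorm A where
  toFun a := ‖f a‖
  nonneg a := norm_nonneg _
  add_le a b := by rw [map_add]; exact norm_add_le _ _
  smul c a := by rw [map_smul, norm_smul]
  mul_le a b := by rw [map_mul]; exact norm_mul_le _ _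
  star_mul_self a := by rw [map_mul, StarHomClass.map_star, CStarRing.norm_star_mul_self]

namespace CStarSeminorm.Completion

variable {A B : Type} [Ring A] [StarRing A] [Algebra ℂ A] [StarModule ℂ A] [CStarAlgebra B]
  (p : CStarSeminorm A)

/-- The extension by continuity of a contractive `*`-homomorphism into a C*-algebra. -/
def extend (f : A →⋆ₐ[ℂ] B) (hf : ∀ a, ‖f a‖ ≤ p a) : p.Completion →⋆ₐ[ℂ] B :=
  have hu : UniformContinuous (α := p.Pre) (β := B) f :=
    (AddMonoidHomClass.lipschitz_of_bound (E := p.Pre) (F := B) (f : A →+ B) 1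
      (fun a => by rw [one_mul]; exact hf a)).uniformContinuous
  have hc : Continuous (UniformSpace.Completion.extension (α := p.Pre) (β := B) f :
      p.Completion → B) := UniformSpace.Completion.continuous_extension
  have ho : ∀ a, (UniformSpace.Completion.extension (α := p.Pre) (β := B) f :
      p.Completion → B) (of p a) = f a := fun a =>
    UniformSpace.Completion.extension_coe hu a
  have hs := continuous_star p
  { toFun := UniformSpace.Completion.extension (α := p.Pre) (β := B) f
    map_one' := by rw [← of_one, ho, map_one]
    -- Each algebraic identity is a closed condition, by continuity of the extension, and holds on
    -- the dense image of `A`.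
    map_mul' := fun x y => by
      refine induction₂ p (isClosed_eq (by fun_prop) (by fun_prop)) (fun a b => ?_) x y
      simp only [← of_mul, ho, map_mul]
    map_zero' := by
      have h : of p 0 = 0 := (ofHom p).map_zero'
      rw [← h, ho, _root_.map_zero]
    map_add' := fun x y => by
      refine induction₂ p (isClosed_eq (by fun_prop) (by fun_prop)) (fun a b => ?_) x y
      simp only [← of_add, ho, map_add]
    commutes' := fun c => by
      rw [Algebra.algebraMap_eq_smul_one, Algebra.algebraMap_eq_smul_one, ← of_one, ← of_smul, ho,
        map_smul, map_one]
    map_star' := fun x => by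
      refine induction p (isClosed_eq (by fun_prop) (by fun_prop)) (fun a => ?_) x
      simp only [← of_star, ho, StarHomClass.map_star] }

theorem extend_of (f : A →⋆ₐ[ℂ] B) (hf : ∀ a, ‖f a‖ ≤ p a) (a : A) :
    extend p f hf (of p a) = f a :=
  UniformSpace.Completion.extension_coe (α := p.Pre) (β := B)
    (AddMonoidHomClass.lipschitz_of_bound (E := p.Pre) (F := B) (f : A →+ B) 1
      (fun a => by rw [one_mul]; exact hf a)).uniformContinuous a

end CStarSeminorm.Completion

namespace CStarPresentation

open CStarSeminorm.Completion FreeStarAlgebra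

variable {X B : Type} (P : CStarPresentation X) [CStarAlgebra B]

theorem of_letter (x : X) (s : Bool) : of P.seminorm (letter x s) = adj (P.gen x) s := by
  cases s
  · rfl
  · change _ = star (of _ _)
    rw [← of_star, FreeStarAlgebra.gen, star_letter]
    rfl

/-- The relations hold in the universal C*-algebra. -/
theorem of_eq_of_rel {a b : FreeStarAlgebra X} (h : P.rel a b) :
    ofHom P.seminorm a = ofHom P.seminorm b := by
  rw [← sub_eq_zero, ← map_sub, ← norm_eq_zero]
  refine (norm_of _ _).trans (le_antisymm ?_ (P.seminorm.nonneg _))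
  refine Real.sSup_le ?_ le_rfl
  rintro _ ⟨p, hp, rfl⟩
  exact (hp a b h).le

theorem ofHom_eq_lift (a : FreeStarAlgebra X) :
    ofHom P.seminorm a = FreeStarAlgebra.lift P.gen a := by
  induction a using FreeStarAlgebra.induction with
  | scalar r => rw [AlgHomClass.commutes, AlgHomClass.commutes]
  | letter x s => rw [lift_letter, ← of_letter]; rfl
  | mul a b ha hb => rw [map_mul, ha, hb, map_mul]
  | add a b ha hb => rw [map_add, ha, hb, map_add]

/-- The relations known in the universal algebra thereby take the same form as the hypothesis of
`CStarPresentation.lift`, so one can be fed into the other. -/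
theorem lift_gen_eq_of_rel {a b : FreeStarAlgebra X} (h : P.rel a b) :
    FreeStarAlgebra.lift P.gen a = FreeStarAlgebra.lift P.gen b := by
  rw [← ofHom_eq_lift, ← ofHom_eq_lift, P.of_eq_of_rel h]

/-- The universal property of the universal C*-algebra. -/
def lift (f : X → B)
    (hf : ∀ a b, P.rel a b → FreeStarAlgebra.lift f a = FreeStarAlgebra.lift f b) :
    P.Universal →⋆ₐ[ℂ] B :=
  extend P.seminorm (FreeStarAlgebra.lift f) fun a =>
    -- The seminorm `‖FreeStarAlgebra.lift f ·‖` kills the relations, so it is one of those whose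
    -- supremum is the norm of the universal algebra.
    CStarSeminorm.le_sup P.admissible P.admissible_bounded
      (p := CStarSeminorm.ofStarAlgHom (FreeStarAlgebra.lift f))
      (fun a b h => by
        change ‖FreeStarAlgebra.lift f (a - b)‖ = 0
        rw [map_sub, hf a b h, sub_self, norm_zero]) a

theorem lift_gen (f : X → B)
    (hf : ∀ a b, P.rel a b → FreeStarAlgebra.lift f a = FreeStarAlgebra.lift f b) (x : X) :
    P.lift f hf (P.gen x) = f x :=
  (extend_of _ _ _ _).trans (FreeStarAlgebra.lift_gen f x)

/-- A closed linear subspace containing `1` and stable under left multiplication by the generators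
and their adjoints is everything. -/
theorem mem_of_isClosed (V : Submodule ℂ P.Universal) (hV : IsClosed (V : Set P.Universal))
    (one : 1 ∈ V) (mul : ∀ x s, ∀ b ∈ V, adj (P.gen x) s * b ∈ V) (b : P.Universal) : b ∈ V := by
  -- `V` need not be a subalgebra. Quantifying over all `b ∈ V` lets the product case compose two
  -- left multiplications.
  have key : ∀ (a : FreeStarAlgebra X), ∀ b ∈ V, of P.seminorm a * b ∈ V := by
    intro a
    induction a using FreeStarAlgebra.induction with
    | scalar r =>
      intro b hb
      rw [Algebra.algebraMap_eq_smul_one, of_smul, of_one, smul_mul_assoc, one_mul]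
      exact V.smul_mem r hb
    | letter x s => intro b hb; rw [of_letter]; exact mul x s b hb
    | mul a a' ha ha' => intro b hb; rw [of_mul, mul_assoc]; exact ha _ (ha' b hb)
    | add a a' ha ha' => intro b hb; rw [of_add, add_mul]; exact V.add_mem (ha b hb) (ha' b hb)
  refine CStarSeminorm.Completion.induction P.seminorm hV (fun a => ?_) b
  simpa using key a 1 one

end CStarPresentation

theorem StarAlgHom.continuous_of_cstarAlgebra {A B : Type} [CStarAlgebra A] [CStarAlgebra B]
    (f : A →⋆ₐ[ℂ] B) : Continuous f :=
  AddMonoidHomClass.continuous_of_bound f 1 fun a => by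
    rw [one_mul]; exact NonUnitalStarAlgHom.norm_apply_le f a

theorem sum_reverse {ι M : Type} [AddCommMonoid M] (t : Finset ι) (f : ι → ι → ι → M) :
    ∑ i ∈ t, ∑ j ∈ t, ∑ k ∈ t, f i j k = ∑ k ∈ t, ∑ j ∈ t, ∑ i ∈ t, f i j k := by
  rw [Finset.sum_comm, Finset.sum_congr rfl fun j _ => Finset.sum_comm, Finset.sum_comm]

/-! ### Calculus of elementary tensors, and the associativity graph. -/

namespace MinTensor

open CStarSeminorm.Completion

variable {A B C : Type} [CStarAlgebra A] [CStarAlgebra B] [CStarAlgebra C]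

theorem tmul_mul_tmul (a a' : A) (b b' : B) :
    tmul a b * tmul a' b' = tmul (a * a') (b * b') := by
  rw [tmul, tmul, ← of_mul, Algebra.TensorProduct.tmul_mul_tmul]; rfl

theorem one_tmul_one : tmul (1 : A) (1 : B) = 1 := of_one _

theorem star_tmul (a : A) (b : B) : star (tmul a b) = tmul (star a) (star b) := by
  rw [tmul, ← of_star, TensorProduct.star_tmul]; rfl

/-- The bilinear map `(a, b) ↦ a ⊗ b`. -/
def tmulₗ : A →ₗ[ℂ] B →ₗ[ℂ] MinTensor A B :=
  (TensorProduct.mk ℂ A B).compr₂ (ofHom (minSeminorm A B)).toAlgHom.toLinearMap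

theorem tmulₗ_apply (a : A) (b : B) : tmulₗ a b = tmul a b := rfl

theorem sum_tmul {ι : Type} (t : Finset ι) (a : ι → A) (b : B) :
    tmul (∑ i ∈ t, a i) b = ∑ i ∈ t, tmul (a i) b := by
  simp only [← tmulₗ_apply, map_sum, LinearMap.sum_apply]

theorem tmul_sum {ι : Type} (t : Finset ι) (a : A) (b : ι → B) :
    tmul a (∑ i ∈ t, b i) = ∑ i ∈ t, tmul a (b i) := by
  simp only [← tmulₗ_apply, map_sum]

theorem zsmul_tmul_zsmul (m n : ℤ) (a : A) (b : B) :
    tmul (m • a) (n • b) = (m * n) • tmul a b := by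
  simp only [← tmulₗ_apply, map_zsmul, LinearMap.smul_apply, smul_smul, mul_comm]

theorem zero_tmul (b : B) : tmul (0 : A) b = 0 := by
  simp only [← tmulₗ_apply, map_zero, LinearMap.zero_apply]

theorem tmul_zero (a : A) : tmul a (0 : B) = 0 := by
  simp only [← tmulₗ_apply, map_zero]

theorem adj_tmul (a : A) (b : B) (s : Bool) : adj (tmul a b) s = tmul (adj a s) (adj b s) := by
  cases s <;> simp [adj, star_tmul]

/-- The star of a tensor acts on each leg without exchanging them, so the same `s` passes to both.
Relations for a letter and for its adjoint can then be treated at once. -/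
theorem adj_sum_tmul {ι : Type} (t : Finset ι) (a : ι → A) (b : ι → B) (s : Bool) :
    adj (∑ i ∈ t, tmul (a i) (b i)) s = ∑ i ∈ t, tmul (adj (a i) s) (adj (b i) s) := by
  simp only [adj_sum, adj_tmul]

theorem sum_tmul_mul_sum_tmul {ι κ : Type} (t : Finset ι) (t' : Finset κ) (a : ι → A) (b : ι → B)
    (a' : κ → A) (b' : κ → B) :
    (∑ i ∈ t, tmul (a i) (b i)) * ∑ j ∈ t', tmul (a' j) (b' j) =
      ∑ i ∈ t, ∑ j ∈ t', tmul (a i * a' j) (b i * b' j) := by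
  simp only [Finset.sum_mul_sum, tmul_mul_tmul]

theorem triple_sum_tmul {ι : Type} (t : Finset ι) (a a' a'' : ι → A) (b b' b'' : ι → B) :
    (∑ i ∈ t, tmul (a i) (b i)) * (∑ j ∈ t, tmul (a' j) (b' j)) * ∑ k ∈ t, tmul (a'' k) (b'' k) =
      ∑ i ∈ t, ∑ j ∈ t, ∑ k ∈ t, tmul (a i * a' j * a'' k) (b i * b' j * b'' k) := by
  simp only [Finset.sum_mul, Finset.mul_sum, tmul_mul_tmul]
  exact sum_reverse _ _

/-- The `*`-homomorphism `b ↦ 1 ⊗ b`. -/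
def inclRight : B →⋆ₐ[ℂ] MinTensor A B where
  toFun b := tmul 1 b
  map_one' := one_tmul_one
  map_mul' b b' := by rw [tmul_mul_tmul, one_mul]
  map_zero' := tmul_zero 1
  map_add' b b' := by simp only [← tmulₗ_apply, map_add]
  commutes' c := by
    rw [Algebra.algebraMap_eq_smul_one, Algebra.algebraMap_eq_smul_one, ← one_tmul_one]
    simp only [← tmulₗ_apply, map_smul]
  map_star' b := by rw [star_tmul, star_one]

theorem dense_span_tmul :
    Dense (Submodule.span ℂ {x : MinTensor A B | ∃ a b, x = tmul a b} : Set (MinTensor A B)) := by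
  refine (denseRange_of (minSeminorm A B)).mono ?_
  rintro _ ⟨x, rfl⟩
  induction x with
  | zero =>
    have h : of (minSeminorm A B) 0 = 0 := (ofHom _).map_zero'
    rw [h]; exact Submodule.zero_mem _
  | add x y hx hy => rw [of_add]; exact Submodule.add_mem _ hx hy
  | tmul a b => exact Submodule.subset_span ⟨a, b, rfl⟩

/-- The subalgebra of `((A ⊗ B) ⊗ C) × (A ⊗ (B ⊗ C))` whose closure is the graph of the
associativity isomorphism. -/
def triples (A B C : Type) [CStarAlgebra A] [CStarAlgebra B] [CStarAlgebra C] :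
    Subalgebra ℂ (MinTensor (MinTensor A B) C × MinTensor A (MinTensor B C)) :=
  Submodule.toSubalgebra
    (Submodule.span ℂ {t | ∃ (a : A) (b : B) (c : C), t = (tmul (tmul a b) c, tmul a (tmul b c))})
    (Submodule.subset_span ⟨1, 1, 1, by simp only [one_tmul_one]; rfl⟩)
    (fun x y hx hy => by
      refine Submodule.span_induction₂ (p := fun x y _ _ => x * y ∈ Submodule.span ℂ _) ?_ ?_ ?_ ?_ ?_ ?_ ?_ hx hy
      · rintro _ _ ⟨a, b, c, rfl⟩ ⟨a', b', c', rfl⟩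
        refine Submodule.subset_span ⟨a * a', b * b', c * c', ?_⟩
        simp only [Prod.mk_mul_mk, tmul_mul_tmul]
      · intro y _; rw [zero_mul]; exact Submodule.zero_mem _
      · intro y _; rw [mul_zero]; exact Submodule.zero_mem _
      · intro x y z _ _ _ h h'; rw [add_mul]; exact Submodule.add_mem _ h h'
      · intro x y z _ _ _ h h'; rw [mul_add]; exact Submodule.add_mem _ h h'
      · intro r x y _ _ h; rw [smul_mul_assoc]; exact Submodule.smul_mem _ r h
      · intro r x y _ _ h; rw [mul_smul_comm]; exact Submodule.smul_mem _ r h)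

theorem mk_mem_triples (a : A) (b : B) (c : C) :
    (tmul (tmul a b) c, tmul a (tmul b c)) ∈ triples A B C :=
  Submodule.subset_span ⟨a, b, c, rfl⟩

theorem SameTriple.tmul (a : A) (b : B) (c : C) :
    SameTriple (tmul (tmul a b) c) (MinTensor.tmul a (MinTensor.tmul b c)) :=
  -- `SameTriple` unfolds to membership in the topological closure of `triples`, which is again a
  -- subalgebra.
  (triples A B C).le_topologicalClosure (mk_mem_triples a b c)

theorem SameTriple.sum {ι : Type} (t : Finset ι) {x : ι → MinTensor (MinTensor A B) C}
    {y : ι → MinTensor A (MinTensor B C)} (h : ∀ i ∈ t, SameTriple (x i) (y i)) :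
    SameTriple (∑ i ∈ t, x i) (∑ i ∈ t, y i) := by
  have h1 : ∑ i ∈ t, (x i, y i) ∈ (triples A B C).topologicalClosure :=
    Subalgebra.sum_mem _ fun i hi => h i hi
  have h2 : ∑ i ∈ t, (x i, y i) = (∑ i ∈ t, x i, ∑ i ∈ t, y i) :=
    Prod.ext Prod.fst_sum Prod.snd_sum
  rw [h2] at h1
  exact h1

/-- Two `*`-homomorphisms into the two triple tensor products correspond to each other if they do
so on generators and their adjoints. -/
theorem sameTriple_of_generators {X : Type} (P : CStarPresentation X)
    (F : P.Universal →⋆ₐ[ℂ] MinTensor (MinTensor A B) C)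
    (G : P.Universal →⋆ₐ[ℂ] MinTensor A (MinTensor B C))
    (h : ∀ x s, SameTriple (F (adj (P.gen x) s)) (G (adj (P.gen x) s))) (b : P.Universal) :
    SameTriple (F b) (G b) := by
  -- `S` consists of the `b` whose pair `(F b, G b)` lies in the closed graph. It is a subalgebra,
  -- and closed because `*`-homomorphisms of C*-algebras are continuous.
  let S := (triples A B C).topologicalClosure.comap (AlgHom.prod F.toAlgHom G.toAlgHom)
  refine P.mem_of_isClosed (Subalgebra.toSubmodule S) ?_ S.one_mem
    (fun x s b hb => S.mul_mem (h x s) hb) b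
  exact (Subalgebra.isClosed_topologicalClosure _).preimage
    ((StarAlgHom.continuous_of_cstarAlgebra F).prodMk (StarAlgHom.continuous_of_cstarAlgebra G))

end MinTensor

open MinTensor

/-! ### Commutation relations for sums of elementary tensors. -/

section Relations

variable {X Y Z : Type}

/-- If the families `p` and `q` satisfy commutation relations of some kind, then so does the family
`f x = ∑ m, p (l x m) ⊗ q (r x m)`, provided that the signs multiply. -/
theorem CommutationRel.lift_eq {A B κ : Type} [CStarAlgebra A] [CStarAlgebra B] [Fintype κ]
    {σ₂ : X → X → ℤ} {σ₃ : X → X → X → ℤ} {τ₂ : Y → Y → ℤ} {τ₃ : Y → Y → Y → ℤ}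
    {ρ₂ : Z → Z → ℤ} {ρ₃ : Z → Z → Z → ℤ} {t : Kind} (p : Y → A) (q : Z → B)
    (hp : ∀ a b, CommutationRel τ₂ τ₃ t a b →
      FreeStarAlgebra.lift p a = FreeStarAlgebra.lift p b)
    (hq : ∀ a b, CommutationRel ρ₂ ρ₃ t a b →
      FreeStarAlgebra.lift q a = FreeStarAlgebra.lift q b)
    (l : X → κ → Y) (r : X → κ → Z)
    (h₂ : ∀ x y m n, τ₂ (l x m) (l y n) * ρ₂ (r x m) (r y n) = σ₂ x y)
    (h₃ : ∀ x y z m n o,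
      τ₃ (l x m) (l y n) (l z o) * ρ₃ (r x m) (r y n) (r z o) = σ₃ x y z)
    {a b : FreeStarAlgebra X} (h : CommutationRel σ₂ σ₃ t a b) :
    FreeStarAlgebra.lift (fun x => ∑ m, tmul (p (l x m)) (q (r x m))) a =
      FreeStarAlgebra.lift (fun x => ∑ m, tmul (p (l x m)) (q (r x m))) b := by
  cases h with
  | classical x y s u =>
    simp only [map_mul, FreeStarAlgebra.lift_letter, adj_sum_tmul, sum_tmul_mul_sum_tmul]
    -- The left side is summed over `m` (attached to `x`) and then `n`, the right side in the
    -- opposite order. Once aligned, the sides agree term by term, by one commutation in each leg.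
    rw [Finset.sum_comm]
    refine Finset.sum_congr rfl fun n _ => Finset.sum_congr rfl fun m _ => ?_
    have h1 := hp _ _ (.classical (l x m) (l y n) s u)
    have h2 := hq _ _ (.classical (r x m) (r y n) s u)
    simp only [map_mul, FreeStarAlgebra.lift_letter] at h1 h2
    rw [h1, h2]
  | twisted x y s u =>
    simp only [map_mul, map_zsmul, FreeStarAlgebra.lift_letter, adj_sum_tmul,
      sum_tmul_mul_sum_tmul, Finset.smul_sum]
    rw [Finset.sum_comm]
    refine Finset.sum_congr rfl fun n _ => Finset.sum_congr rfl fun m _ => ?_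
    have h1 := hp _ _ (.twisted (l x m) (l y n) s u)
    have h2 := hq _ _ (.twisted (r x m) (r y n) s u)
    simp only [map_mul, map_zsmul, FreeStarAlgebra.lift_letter] at h1 h2
    -- Each leg contributes its own sign. By `h₂` the product is the same for all `m`, `n`, which is
    -- what the single scalar on the right side requires.
    rw [h1, h2, zsmul_tmul_zsmul, h₂]
  | halfClassical x y z s u v =>
    simp only [map_mul, FreeStarAlgebra.lift_letter, adj_sum_tmul, triple_sum_tmul]
    -- The relation reverses three factors, so the three summations must be reversed before
    -- comparing terms.
    rw [sum_reverse]
    refine Finset.sum_congr rfl fun o _ => Finset.sum_congr rfl fun n _ =>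
      Finset.sum_congr rfl fun m _ => ?_
    have h1 := hp _ _ (.halfClassical (l x m) (l y n) (l z o) s u v)
    have h2 := hq _ _ (.halfClassical (r x m) (r y n) (r z o) s u v)
    simp only [map_mul, FreeStarAlgebra.lift_letter] at h1 h2
    rw [h1, h2]
  | twistedHalfClassical x y z s u v =>
    simp only [map_mul, map_zsmul, FreeStarAlgebra.lift_letter, adj_sum_tmul, triple_sum_tmul,
      Finset.smul_sum]
    rw [sum_reverse]
    refine Finset.sum_congr rfl fun o _ => Finset.sum_congr rfl fun n _ =>
      Finset.sum_congr rfl fun m _ => ?_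
    have h1 := hp _ _ (.twistedHalfClassical (l x m) (l y n) (l z o) s u v)
    have h2 := hq _ _ (.twistedHalfClassical (r x m) (r y n) (r z o) s u v)
    simp only [map_mul, map_zsmul, FreeStarAlgebra.lift_letter] at h1 h2
    rw [h1, h2, zsmul_tmul_zsmul, h₃]

end Relations

/-! ### Multiplicativity of the signs. -/

/-- `groupSign₂` is `-1` exactly when one of the two coordinates agrees and the other differs, so it
is the product of `sphereSign₂` on rows and on columns. The sign of `m`, `n` then occurs twice and
cancels. The case split on the three equalities verifies this directly. -/
theorem groupSign₂_mul_groupSign₂ {N : ℕ} (a b : Fin N × Fin N) (m n : Fin N) :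
    groupSign₂ (a.1, m) (b.1, n) * groupSign₂ (m, a.2) (n, b.2) = groupSign₂ a b := by
  simp only [groupSign₂, ne_eq, Prod.ext_iff]
  by_cases h1 : a.1 = b.1 <;> by_cases h2 : a.2 = b.2 <;> by_cases h3 : m = n <;> simp [*]

theorem groupSign₂_mul_sphereSign₂ {N : ℕ} (i j m n : Fin N) :
    groupSign₂ (i, m) (j, n) * sphereSign₂ m n = sphereSign₂ i j := by
  simp only [groupSign₂, sphereSign₂, ne_eq, Prod.ext_iff]
  by_cases h1 : i = j <;> by_cases h3 : m = n <;> simp [*]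

theorem card_triple {N : ℕ} (i j k : Fin N) :
    ({i, j, k} : Finset (Fin N)).card = 3 ↔ i ≠ j ∧ i ≠ k ∧ j ≠ k := by
  constructor
  · intro h
    refine ⟨?_, ?_, ?_⟩ <;> rintro rfl <;> simp only [Finset.mem_insert, Finset.mem_singleton,
      true_or, or_true, Finset.insert_eq_of_mem] at h
    all_goals exact absurd (h ▸ Finset.card_le_two) (by norm_num)
  · rintro ⟨h1, h2, h3⟩
    exact Finset.card_eq_three.mpr ⟨i, j, k, h1, h2, h3, rfl⟩

/-- A sphere sign is `-1` when the three indices span 3 values. The group sign is `-1` when exactly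
one of the row and column counts is 3, which is when the product of the two sphere signs is `-1`. -/
theorem groupSign₃_eq {N : ℕ} (a b c : Fin N × Fin N) :
    groupSign₃ a b c = sphereSign₃ a.1 b.1 c.1 * sphereSign₃ a.2 b.2 c.2 := by
  have h : ∀ i j k : Fin N, sphereSign₃ i j k =
      if ({i, j, k} : Finset (Fin N)).card = 3 then -1 else 1 := fun i j k => by
    simp only [sphereSign₃, card_triple]
  -- The bound by 3 makes `≤ 2` the negation of `= 3`, which `omega` needs to discard the mixed
  -- cases.
  have hle : ∀ i j k : Fin N, ({i, j, k} : Finset (Fin N)).card ≤ 3 := fun _ _ _ =>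
    Finset.card_le_three
  have h1 := hle a.1 b.1 c.1
  have h2 := hle a.2 b.2 c.2
  simp only [h, groupSign₃]
  split_ifs <;> first | rfl | omega

theorem sphereSign₃_mul_self {N : ℕ} (i j k : Fin N) :
    sphereSign₃ i j k * sphereSign₃ i j k = 1 := by
  rw [sphereSign₃]; split_ifs <;> rfl

theorem groupSign₃_mul_groupSign₃ {N : ℕ} (a b c : Fin N × Fin N) (m n o : Fin N) :
    groupSign₃ (a.1, m) (b.1, n) (c.1, o) * groupSign₃ (m, a.2) (n, b.2) (o, c.2) =
      groupSign₃ a b c := by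
  simp only [groupSign₃_eq]
  linear_combination sphereSign₃ a.1 b.1 c.1 * sphereSign₃ a.2 b.2 c.2 *
    sphereSign₃_mul_self m n o

theorem groupSign₃_mul_sphereSign₃ {N : ℕ} (i j k m n o : Fin N) :
    groupSign₃ (i, m) (j, n) (k, o) * sphereSign₃ m n o = sphereSign₃ i j k := by
  simp only [groupSign₃_eq]
  linear_combination sphereSign₃ i j k * sphereSign₃_mul_self m n o

/-! ### Biunitary matrices and the defining relations. -/

section Coordinates

variable {𝕂 : Ground} {t : Kind} {N : ℕ} {A B : Type} [CStarAlgebra A] [CStarAlgebra B]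

/-- The matrix `u` and its entrywise adjoint are unitary. -/
structure IsBiunitary (u : Fin N × Fin N → A) : Prop where
  row : ∀ s i j, ∑ k, adj (u (i, k)) s * adj (u (j, k)) (!s) = if i = j then 1 else 0
  col : ∀ s i j, ∑ k, adj (u (k, i)) s * adj (u (k, j)) (!s) = if i = j then 1 else 0

theorem FreeStarAlgebra.lift_ite_one (f : Fin N × Fin N → A) (i j : Fin N) :
    FreeStarAlgebra.lift f (if i = j then 1 else 0) = if i = j then 1 else 0 := by
  split_ifs
  · exact map_one _
  · exact map_zero _

/-- The index `s` folds four relations into two: `row` is $uu^*=1$ at `false` and $\bar uu^t=1$ at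
`true`, while `col` is $u^t\bar u=1$ at `false` and $u^*u=1$ at `true`. -/
theorem isBiunitary_of_groupRel (u : Fin N × Fin N → A)
    (h : ∀ a b, GroupRel 𝕂 t N a b → FreeStarAlgebra.lift u a = FreeStarAlgebra.lift u b) :
    IsBiunitary u := by
  constructor <;> rintro (_ | _) i j
  · simpa [map_sum, map_star, FreeStarAlgebra.lift_gen, FreeStarAlgebra.lift_ite_one, adj]
      using h _ _ (.mul_adjoint i j)
  · simpa [map_sum, map_star, FreeStarAlgebra.lift_gen, FreeStarAlgebra.lift_ite_one, adj]
      using h _ _ (.conj_mul_transpose i j)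
  · simpa [map_sum, map_star, FreeStarAlgebra.lift_gen, FreeStarAlgebra.lift_ite_one, adj]
      using h _ _ (.transpose_mul_conj i j)
  · simpa [map_sum, map_star, FreeStarAlgebra.lift_gen, FreeStarAlgebra.lift_ite_one, adj]
      using h _ _ (.adjoint_mul i j)

theorem GroupRel.lift_eq (u : Fin N × Fin N → A) (hu : IsBiunitary u)
    (hreal : 𝕂 = .real → ∀ x, star (u x) = u x)
    (hcomm : ∀ a b, CommutationRel groupSign₂ groupSign₃ t a b →
      FreeStarAlgebra.lift u a = FreeStarAlgebra.lift u b)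
    {a b : FreeStarAlgebra (Fin N × Fin N)} (h : GroupRel 𝕂 t N a b) :
    FreeStarAlgebra.lift u a = FreeStarAlgebra.lift u b := by
  cases h with
  | mul_adjoint i j =>
    simpa [map_sum, map_star, FreeStarAlgebra.lift_gen, FreeStarAlgebra.lift_ite_one, adj]
      using hu.row false i j
  | adjoint_mul i j =>
    simpa [map_sum, map_star, FreeStarAlgebra.lift_gen, FreeStarAlgebra.lift_ite_one, adj]
      using hu.col true i j
  | transpose_mul_conj i j =>
    simpa [map_sum, map_star, FreeStarAlgebra.lift_gen, FreeStarAlgebra.lift_ite_one, adj]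
      using hu.col false i j
  | conj_mul_transpose i j =>
    simpa [map_sum, map_star, FreeStarAlgebra.lift_gen, FreeStarAlgebra.lift_ite_one, adj]
      using hu.row true i j
  | real h i j => rw [map_star, FreeStarAlgebra.lift_gen, hreal h]
  | comm a b h => exact hcomm _ _ h

theorem SphereRel.lift_eq (z : Fin N → A) (hz : ∀ s, ∑ i, adj (z i) s * adj (z i) (!s) = 1)
    (hreal : 𝕂 = .real → ∀ i, star (z i) = z i)
    (hcomm : ∀ a b, CommutationRel sphereSign₂ sphereSign₃ t a b →
      FreeStarAlgebra.lift z a = FreeStarAlgebra.lift z b)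
    {a b : FreeStarAlgebra (Fin N)} (h : SphereRel 𝕂 t N a b) :
    FreeStarAlgebra.lift z a = FreeStarAlgebra.lift z b := by
  cases h with
  | sum_mul_star => simpa [map_sum, map_star, FreeStarAlgebra.lift_gen, adj] using hz false
  | sum_star_mul => simpa [map_sum, map_star, FreeStarAlgebra.lift_gen, adj] using hz true
  | real h i => rw [map_star, FreeStarAlgebra.lift_gen, hreal h]
  | comm a b h => exact hcomm _ _ h

theorem sum_adj_of_sphereRel (z : Fin N → A)
    (h : ∀ a b, SphereRel 𝕂 t N a b → FreeStarAlgebra.lift z a = FreeStarAlgebra.lift z b)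
    (s : Bool) : ∑ i, adj (z i) s * adj (z i) (!s) = 1 := by
  cases s
  · simpa [map_sum, map_star, FreeStarAlgebra.lift_gen, adj] using h _ _ .sum_mul_star
  · simpa [map_sum, map_star, FreeStarAlgebra.lift_gen, adj] using h _ _ .sum_star_mul

/-- The product of two biunitary matrices, with entries in the two factors of a tensor product. -/
theorem IsBiunitary.tmul {u : Fin N × Fin N → A} {v : Fin N × Fin N → B} (hu : IsBiunitary u)
    (hv : IsBiunitary v) :
    IsBiunitary fun x : Fin N × Fin N => ∑ k, MinTensor.tmul (u (x.1, k)) (v (k, x.2)) where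
  row s i j := by
    simp only [adj_sum_tmul, sum_tmul_mul_sum_tmul]
    -- The outer index `k` moves innermost. It occurs only in the `v` leg, where the row relation of
    -- `v` gives $\delta_{mn}$; the row relation of `u` finishes.
    rw [Finset.sum_comm, Finset.sum_congr rfl fun m _ => Finset.sum_comm]
    simp only [← tmul_sum, hv.row]
    have h : ∀ m n, MinTensor.tmul (adj (u (i, m)) s * adj (u (j, n)) (!s))
        (if m = n then (1 : B) else 0) = if m = n then
          MinTensor.tmul (adj (u (i, m)) s * adj (u (j, n)) (!s)) 1 else 0 := fun m n => by
      split_ifs <;> simp [tmul_zero]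
    simp only [h, Finset.sum_ite_eq, Finset.mem_univ, if_true, ← sum_tmul, hu.row]
    split_ifs
    · exact one_tmul_one
    · exact zero_tmul _
  col s i j := by
    simp only [adj_sum_tmul, sum_tmul_mul_sum_tmul]
    -- For columns the outer index sits in the `u` leg, so `u` is contracted first and `v` second.
    rw [Finset.sum_comm, Finset.sum_congr rfl fun m _ => Finset.sum_comm]
    simp only [← sum_tmul, hu.col]
    have h : ∀ m n, MinTensor.tmul (if m = n then (1 : A) else 0)
        (adj (v (m, i)) s * adj (v (n, j)) (!s)) = if m = n then
          MinTensor.tmul 1 (adj (v (m, i)) s * adj (v (n, j)) (!s)) else 0 := fun m n => by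
      split_ifs <;> simp [zero_tmul]
    simp only [h, Finset.sum_ite_eq, Finset.mem_univ, if_true, ← tmul_sum, hv.col]
    split_ifs
    · exact one_tmul_one
    · exact tmul_zero _

/-- A biunitary matrix maps the sphere to the sphere. -/
theorem IsBiunitary.sum_adj_tmul {u : Fin N × Fin N → A} (hu : IsBiunitary u) {z : Fin N → B}
    (hz : ∀ s, ∑ i, adj (z i) s * adj (z i) (!s) = 1) (s : Bool) :
    ∑ i, adj (∑ k, MinTensor.tmul (u (i, k)) (z k)) s *
      adj (∑ k, MinTensor.tmul (u (i, k)) (z k)) (!s) = 1 := by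
  simp only [adj_sum_tmul, sum_tmul_mul_sum_tmul]
  -- Summing over `i` in the `u` leg gives $\delta_{mn}$ by the column relation, leaving the sphere
  -- equation in the second leg.
  rw [Finset.sum_comm, Finset.sum_congr rfl fun m _ => Finset.sum_comm]
  simp only [← sum_tmul, hu.col]
  have h : ∀ m n, MinTensor.tmul (if m = n then (1 : A) else 0)
      (adj (z m) s * adj (z n) (!s)) = if m = n then
        MinTensor.tmul 1 (adj (z m) s * adj (z n) (!s)) else 0 := fun m n => by
    split_ifs <;> simp [zero_tmul]
  simp only [h, Finset.sum_ite_eq, Finset.mem_univ, if_true, ← tmul_sum, hz, one_tmul_one]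

end Coordinates

/-! ### The comultiplication, the counit and the action. -/

section Maps

variable (𝕂 : Ground) (t : Kind) (N : ℕ)

theorem isBiunitary_groupCoord : IsBiunitary (groupPresentation 𝕂 t N).gen :=
  isBiunitary_of_groupRel (𝕂 := 𝕂) (t := t) _ fun _ _ h =>
    (groupPresentation 𝕂 t N).lift_gen_eq_of_rel h

theorem star_group_gen (h : 𝕂 = .real) (x : Fin N × Fin N) :
    star ((groupPresentation 𝕂 t N).gen x) = (groupPresentation 𝕂 t N).gen x := by
  have h1 := (groupPresentation 𝕂 t N).lift_gen_eq_of_rel (.real h x.1 x.2)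
  rw [map_star, FreeStarAlgebra.lift_gen] at h1
  exact h1.symm

theorem star_sphere_gen (h : 𝕂 = .real) (i : Fin N) :
    star ((spherePresentation 𝕂 t N).gen i) = (spherePresentation 𝕂 t N).gen i := by
  have h1 := (spherePresentation 𝕂 t N).lift_gen_eq_of_rel (.real h i)
  rw [map_star, FreeStarAlgebra.lift_gen] at h1
  exact h1.symm

theorem commutationRel_group {a b : FreeStarAlgebra (Fin N × Fin N)}
    (h : CommutationRel groupSign₂ groupSign₃ t a b) :
    FreeStarAlgebra.lift (groupPresentation 𝕂 t N).gen a =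
      FreeStarAlgebra.lift (groupPresentation 𝕂 t N).gen b :=
  (groupPresentation 𝕂 t N).lift_gen_eq_of_rel (GroupRel.comm _ _ h)

theorem commutationRel_sphere {a b : FreeStarAlgebra (Fin N)}
    (h : CommutationRel sphereSign₂ sphereSign₃ t a b) :
    FreeStarAlgebra.lift (spherePresentation 𝕂 t N).gen a =
      FreeStarAlgebra.lift (spherePresentation 𝕂 t N).gen b :=
  (spherePresentation 𝕂 t N).lift_gen_eq_of_rel (SphereRel.comm _ _ h)

/-- The matrix `∑_k u_ik ⊗ u_kj`. -/
def groupProd (x : Fin N × Fin N) : MinTensor (CGroup 𝕂 t N) (CGroup 𝕂 t N) :=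
  ∑ k, tmul ((groupPresentation 𝕂 t N).gen (x.1, k)) ((groupPresentation 𝕂 t N).gen (k, x.2))

theorem isBiunitary_groupProd : IsBiunitary (groupProd 𝕂 t N) :=
  (isBiunitary_groupCoord 𝕂 t N).tmul (isBiunitary_groupCoord 𝕂 t N)

theorem star_groupProd (h : 𝕂 = .real) (x : Fin N × Fin N) :
    star (groupProd 𝕂 t N x) = groupProd 𝕂 t N x := by
  simp only [groupProd, star_sum, star_tmul, star_group_gen 𝕂 t N h]

theorem commutationRel_groupProd {a b : FreeStarAlgebra (Fin N × Fin N)}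
    (h : CommutationRel groupSign₂ groupSign₃ t a b) :
    FreeStarAlgebra.lift (groupProd 𝕂 t N) a = FreeStarAlgebra.lift (groupProd 𝕂 t N) b :=
  CommutationRel.lift_eq (κ := Fin N) (σ₂ := groupSign₂) (σ₃ := groupSign₃) (τ₂ := groupSign₂)
    (τ₃ := groupSign₃) (ρ₂ := groupSign₂) (ρ₃ := groupSign₃) (groupPresentation 𝕂 t N).gen
    (groupPresentation 𝕂 t N).gen (fun _ _ => commutationRel_group 𝕂 t N)
    (fun _ _ => commutationRel_group 𝕂 t N) (fun x m => (x.1, m)) (fun x m => (m, x.2))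
    groupSign₂_mul_groupSign₂ groupSign₃_mul_groupSign₃ h

/-- The comultiplication `u_ij ↦ ∑_k u_ik ⊗ u_kj`. -/
def comultiplication :
    CGroup 𝕂 t N →⋆ₐ[ℂ] MinTensor (CGroup 𝕂 t N) (CGroup 𝕂 t N) :=
  (groupPresentation 𝕂 t N).lift (groupProd 𝕂 t N) fun _ _ h =>
    GroupRel.lift_eq (groupProd 𝕂 t N) (isBiunitary_groupProd 𝕂 t N) (star_groupProd 𝕂 t N)
      (fun _ _ => commutationRel_groupProd 𝕂 t N) h

/-- The action `z_i ↦ ∑_j u_ij ⊗ z_j`. -/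
def sphereAction : CSphere 𝕂 t N →⋆ₐ[ℂ] MinTensor (CGroup 𝕂 t N) (CSphere 𝕂 t N) :=
  (spherePresentation 𝕂 t N).lift
    (fun i => ∑ j, tmul ((groupPresentation 𝕂 t N).gen (i, j)) ((spherePresentation 𝕂 t N).gen j))
    fun _ _ h => SphereRel.lift_eq (𝕂 := 𝕂) (t := t) _
      ((isBiunitary_groupCoord 𝕂 t N).sum_adj_tmul
        (sum_adj_of_sphereRel (𝕂 := 𝕂) (t := t) _ fun _ _ h' =>
          (spherePresentation 𝕂 t N).lift_gen_eq_of_rel h'))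
      (fun hr i => by
        simp only [star_sum, star_tmul, star_group_gen 𝕂 t N hr, star_sphere_gen 𝕂 t N hr])
      (fun _ _ h' => CommutationRel.lift_eq (groupPresentation 𝕂 t N).gen
        (spherePresentation 𝕂 t N).gen (fun _ _ => commutationRel_group 𝕂 t N)
        (fun _ _ => commutationRel_sphere 𝕂 t N) (fun i m => (i, m)) (fun _ m => m)
        groupSign₂_mul_sphereSign₂ groupSign₃_mul_sphereSign₃ h') h

theorem adj_ite_one (i j : Fin N) (s : Bool) :
    adj (if i = j then (1 : ℂ) else 0) s = if i = j then 1 else 0 := by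
  cases s <;> simp [adj, apply_ite star]

/-- The counit `u_ij ↦ δ_ij`. -/
def counit : CGroup 𝕂 t N →⋆ₐ[ℂ] ℂ :=
  (groupPresentation 𝕂 t N).lift (fun x => if x.1 = x.2 then 1 else 0) fun _ _ h => h.lift_eq _
    ⟨fun s i j => by simp [adj_ite_one, @eq_comm _ j],
      fun s i j => by simp [adj_ite_one, eq_comm]⟩
    (fun _ x => by simp [apply_ite star])
    fun a b h' => by
      cases h' with
      | classical a b s r =>
        simp only [map_mul, FreeStarAlgebra.lift_letter]; ring
      | halfClassical a b c s r q =>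
        simp only [map_mul, FreeStarAlgebra.lift_letter]; ring
      | twisted a b s r =>
        simp only [map_mul, map_zsmul, FreeStarAlgebra.lift_letter, adj_ite_one]
        obtain ⟨i, j⟩ := a
        obtain ⟨k, l⟩ := b
        -- Both sides vanish unless both entries are diagonal. Two diagonal entries on a common row
        -- or column coincide, so the sign is then `1`.
        by_cases h1 : i = j <;> by_cases h2 : k = l <;> simp [h1, h2, groupSign₂]
      | twistedHalfClassical a b c s r q =>
        simp only [map_mul, map_zsmul, FreeStarAlgebra.lift_letter, adj_ite_one]
        obtain ⟨i, j⟩ := a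
        obtain ⟨k, l⟩ := b
        obtain ⟨m, n⟩ := c
        -- For three diagonal entries the row and column indices are the same triple, so the sign is
        -- a square.
        by_cases h1 : i = j <;> by_cases h2 : k = l <;> by_cases h3 : m = n <;>
          simp [h1, h2, h3, groupSign₃_eq, sphereSign₃_mul_self]

variable {N}

theorem comultiplication_groupCoord (i j : Fin N) :
    comultiplication 𝕂 t N (groupCoord 𝕂 t i j) =
      ∑ k, tmul (groupCoord 𝕂 t i k) (groupCoord 𝕂 t k j) :=
  CStarPresentation.lift_gen _ _ _ _

theorem counit_groupCoord (i j : Fin N) :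
    counit 𝕂 t N (groupCoord 𝕂 t i j) = if i = j then 1 else 0 :=
  CStarPresentation.lift_gen _ _ _ _

theorem sphereAction_sphereCoord (i : Fin N) :
    sphereAction 𝕂 t N (sphereCoord 𝕂 t i) =
      ∑ j, tmul (groupCoord 𝕂 t i j) (sphereCoord 𝕂 t j) :=
  CStarPresentation.lift_gen _ _ _ _

theorem comultiplication_adj (i j : Fin N) (s : Bool) :
    comultiplication 𝕂 t N (adj (groupCoord 𝕂 t i j) s) =
      ∑ k, tmul (adj (groupCoord 𝕂 t i k) s) (adj (groupCoord 𝕂 t k j) s) := by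
  rw [map_adj, comultiplication_groupCoord, adj_sum_tmul]

theorem counit_adj (i j : Fin N) (s : Bool) :
    counit 𝕂 t N (adj (groupCoord 𝕂 t i j) s) = if i = j then 1 else 0 := by
  rw [map_adj, counit_groupCoord, adj_ite_one]

theorem sphereAction_adj (i : Fin N) (s : Bool) :
    sphereAction 𝕂 t N (adj (sphereCoord 𝕂 t i) s) =
      ∑ j, tmul (adj (groupCoord 𝕂 t i j) s) (adj (sphereCoord 𝕂 t j) s) := by
  rw [map_adj, sphereAction_sphereCoord, adj_sum_tmul]

/-- Column unitarity inverts the action: multiplying by the adjoint entries and summing over `j`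
contracts the first leg to $\delta_{ki}$. This places the generators of the second leg in the span
of the products $\Phi(x)(a\otimes1)$. -/
theorem sum_sphereAction_adj_mul (i : Fin N) (s : Bool) :
    ∑ j, sphereAction 𝕂 t N (adj (sphereCoord 𝕂 t j) s) *
      tmul (adj (groupCoord 𝕂 t j i) (!s)) 1 = tmul 1 (adj (sphereCoord 𝕂 t i) s) := by
  have hu : ∀ k, ∑ j, adj (groupCoord 𝕂 t j k) s * adj (groupCoord 𝕂 t j i) (!s) =
      if k = i then 1 else 0 := fun k => (isBiunitary_groupCoord 𝕂 t N).col s k i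
  simp only [sphereAction_adj, Finset.sum_mul, tmul_mul_tmul, mul_one]
  rw [Finset.sum_comm]
  simp only [← sum_tmul, hu]
  rw [Finset.sum_eq_single i, if_pos rfl]
  · intro k _ hk; rw [if_neg hk, zero_tmul]
  · simp

/-! ### The axioms of an action. -/

theorem sphereAction_coassoc (x : CSphere 𝕂 t N) :
    SameTriple
      (MinTensor.map (comultiplication 𝕂 t N) (StarAlgHom.id ℂ _) (sphereAction 𝕂 t N x))
      (MinTensor.map (StarAlgHom.id ℂ _) (sphereAction 𝕂 t N) (sphereAction 𝕂 t N x)) := by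
  refine MinTensor.sameTriple_of_generators (spherePresentation 𝕂 t N)
    ((MinTensor.map (comultiplication 𝕂 t N) (StarAlgHom.id ℂ _)).comp (sphereAction 𝕂 t N))
    ((MinTensor.map (StarAlgHom.id ℂ _) (sphereAction 𝕂 t N)).comp (sphereAction 𝕂 t N))
    (fun i s => ?_) x
  change SameTriple
    (MinTensor.map _ _ (sphereAction 𝕂 t N (adj (sphereCoord 𝕂 t i) s)))
    (MinTensor.map _ _ (sphereAction 𝕂 t N (adj (sphereCoord 𝕂 t i) s)))
  simp only [sphereAction_adj, map_sum, map_tmul, comultiplication_adj, sum_tmul, tmul_sum,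
    StarAlgHom.coe_id, id]
  -- Both sides are double sums of $u_{ij}\otimes u_{jk}\otimes z_k$ (up to adjoints), the left one
  -- with the sphere index outermost. After the exchange the terms correspond one by one.
  rw [Finset.sum_comm]
  exact SameTriple.sum _ fun j _ => SameTriple.sum _ fun k _ => SameTriple.tmul _ _ _

theorem sphereAction_counit (x : CSphere 𝕂 t N) :
    MinTensor.map (counit 𝕂 t N) (StarAlgHom.id ℂ _) (sphereAction 𝕂 t N x) = tmul 1 x := by
  let F := (MinTensor.map (counit 𝕂 t N) (StarAlgHom.id ℂ (CSphere 𝕂 t N))).comp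
    (sphereAction 𝕂 t N)
  let G : CSphere 𝕂 t N →⋆ₐ[ℂ] MinTensor ℂ (CSphere 𝕂 t N) := inclRight
  -- Both sides are `*`-homomorphisms in `x`, so the set where they agree is a closed subalgebra.
  let S := AlgHom.equalizer F.toAlgHom G.toAlgHom
  refine (spherePresentation 𝕂 t N).mem_of_isClosed (Subalgebra.toSubmodule S) ?_ S.one_mem
    (fun i s b hb => S.mul_mem (?_ : F (adj (sphereCoord 𝕂 t i) s) = tmul 1 _) hb) x
  · exact isClosed_eq (StarAlgHom.continuous_of_cstarAlgebra F)
      (StarAlgHom.continuous_of_cstarAlgebra G)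
  · change MinTensor.map _ _ (sphereAction 𝕂 t N _) = _
    simp only [sphereAction_adj, map_sum, map_tmul, counit_adj, StarAlgHom.coe_id, id]
    rw [Finset.sum_eq_single i, if_pos rfl]
    · rfl
    · intro k _ hk; rw [if_neg hk.symm, zero_tmul]
    · simp

/-- The span `W` is not visibly an algebra, but it is stable under left multiplication by the range
of $\Phi$ and right multiplication by $C(U_N^\times)\otimes1$, and so is its closure `V`. These two
stabilities suffice to reach every $1\otimes b$, and then every $a\otimes b$. -/
theorem sphereAction_dense :
    Dense ((Submodule.span ℂ {y : MinTensor (CGroup 𝕂 t N) (CSphere 𝕂 t N) |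
      ∃ x a, y = sphereAction 𝕂 t N x * tmul a 1} : Submodule ℂ _) :
        Set (MinTensor (CGroup 𝕂 t N) (CSphere 𝕂 t N))) := by
  let W : Submodule ℂ (MinTensor (CGroup 𝕂 t N) (CSphere 𝕂 t N)) :=
    Submodule.span ℂ {y | ∃ x a, y = sphereAction 𝕂 t N x * tmul a 1}
  let V := W.topologicalClosure
  have hleft : ∀ x, ∀ y ∈ V, sphereAction 𝕂 t N x * y ∈ V := by
    intro x y hy
    -- Multiplication by a fixed element is continuous, so stability need only be checked on `W`.
    refine map_mem_closure (f := fun y => sphereAction 𝕂 t N x * y) (by fun_prop) hy ?_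
    intro y hy
    refine Submodule.span_induction (p := fun y _ => sphereAction 𝕂 t N x * y ∈ W)
      ?_ ?_ ?_ ?_ hy
    · rintro _ ⟨x', a, rfl⟩
      exact Submodule.subset_span ⟨x * x', a, by rw [map_mul, mul_assoc]⟩
    · rw [mul_zero]; exact W.zero_mem
    · intro y y' _ _ h h'; rw [mul_add]; exact W.add_mem h h'
    · intro r y _ h; rw [mul_smul_comm]; exact W.smul_mem r h
  have hright : ∀ a, ∀ y ∈ V, y * tmul a 1 ∈ V := by
    intro a y hy
    refine map_mem_closure (f := fun y => y * tmul a 1) (by fun_prop) hy ?_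
    intro y hy
    refine Submodule.span_induction (p := fun y _ => y * tmul a 1 ∈ W) ?_ ?_ ?_ ?_ hy
    · rintro _ ⟨x, a', rfl⟩
      exact Submodule.subset_span ⟨x, a' * a, by rw [mul_assoc, tmul_mul_tmul, one_mul]⟩
    · rw [zero_mul]; exact W.zero_mem
    · intro y y' _ _ h h'; rw [add_mul]; exact W.add_mem h h'
    · intro r y _ h; rw [smul_mul_assoc]; exact W.smul_mem r h
  have hone : ∀ b, tmul 1 b ∈ V := by
    let G : CSphere 𝕂 t N →⋆ₐ[ℂ] MinTensor (CGroup 𝕂 t N) (CSphere 𝕂 t N) := inclRight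
    intro b
    refine (spherePresentation 𝕂 t N).mem_of_isClosed (V.comap G.toAlgHom.toLinearMap) ?_ ?_ ?_ b
    · exact W.isClosed_topologicalClosure.preimage (StarAlgHom.continuous_of_cstarAlgebra G)
    · refine W.le_topologicalClosure (Submodule.subset_span ⟨1, 1, ?_⟩)
      exact (map_one G).trans (by rw [map_one, one_tmul_one, one_mul])
    · intro i s b hb
      change tmul 1 (adj (sphereCoord 𝕂 t i) s * b) ∈ V
      -- The inversion formula is multiplied by $1\otimes b$, which commutes with the first leg and
      -- can be moved to the left of it. What remains has the form $\Phi(x)\,y\,(a\otimes1)$ with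
      -- $y=1\otimes b$ already in `V`.
      have h : tmul (1 : CGroup 𝕂 t N) (adj (sphereCoord 𝕂 t i) s * b) =
          ∑ j, sphereAction 𝕂 t N (adj (sphereCoord 𝕂 t j) s) *
            (tmul 1 b * tmul (adj (groupCoord 𝕂 t j i) (!s)) 1) := by
        rw [← one_mul (1 : CGroup 𝕂 t N), ← tmul_mul_tmul, ← sum_sphereAction_adj_mul,
          Finset.sum_mul]
        simp only [mul_assoc, tmul_mul_tmul, one_mul, mul_one]
      rw [h]
      exact V.sum_mem fun j _ => hleft _ _ (hright _ _ hb)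
  have hV : Dense (V : Set (MinTensor (CGroup 𝕂 t N) (CSphere 𝕂 t N))) := by
    refine dense_span_tmul.mono (SetLike.coe_subset_coe.mpr (Submodule.span_le.mpr ?_))
    rintro _ ⟨a, b, rfl⟩
    -- Here $a\otimes b=(1\otimes b)(a\otimes1)$.
    have h := hright a _ (hone b)
    rwa [tmul_mul_tmul, one_mul, mul_one] at h
  -- `V` is the closure of `W`, and a set with dense closure is dense.
  exact dense_closure.mp hV

end Maps

/-- Each of the ten quantum groups acts on the corresponding sphere, by
`Φ(z_i) = ∑_j u_ij ⊗ z_j`. Here `Δ` and `ε` are the Hopf algebra maps of the quantum group. -/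
theorem theorem3p7 (𝕂 : Ground) (t : Kind) (N : ℕ) :
    ∃ (Δ : CGroup 𝕂 t N →⋆ₐ[ℂ] MinTensor (CGroup 𝕂 t N) (CGroup 𝕂 t N))
      (ε : CGroup 𝕂 t N →⋆ₐ[ℂ] ℂ),
      (∀ i j, Δ (groupCoord 𝕂 t i j) =
        ∑ k, MinTensor.tmul (groupCoord 𝕂 t i k) (groupCoord 𝕂 t k j)) ∧
      (∀ i j, ε (groupCoord 𝕂 t i j) = if i = j then 1 else 0) ∧
      ∃ Φ : CSphere 𝕂 t N →⋆ₐ[ℂ] MinTensor (CGroup 𝕂 t N) (CSphere 𝕂 t N),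
        (∀ i, Φ (sphereCoord 𝕂 t i) =
          ∑ j, MinTensor.tmul (groupCoord 𝕂 t i j) (sphereCoord 𝕂 t j)) ∧
        IsQuantumGroupAction Δ ε Φ :=
  ⟨comultiplication 𝕂 t N, counit 𝕂 t N, comultiplication_groupCoord 𝕂 t, counit_groupCoord 𝕂 t,
    sphereAction 𝕂 t N, sphereAction_sphereCoord 𝕂 t,
    ⟨sphereAction_coassoc 𝕂 t, sphereAction_counit 𝕂 t, sphereAction_dense 𝕂 t⟩⟩
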